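/- Let $x=(x_0,x_1,\dots)$ be infinitely many variables, $p_k=\sum_i x_i^k$ and $p_\rho=\prod_i p_{\rho_i}$ the power sums. For a partition $\rho$ with $m_i$ parts equal to $i$ let $l(\rho)$ be its number of parts, $z_\rho=\prod_{i\ge1}i^{m_i}m_i!$ and $z_\rho(t)=z_\rho\prod_{j=1}^{l(\rho)}(1-t^{\rho_j})^{-1}$. Put $q_m=\sum_{\rho\vdash m}z_\rho(t)^{-1}p_\rho$ for $m\ge0$ and $q_m=0$ for $m<0$. For a partition $\lambda=(\lambda_1\ge\dots\ge\lambda_l>0)$ the Hall–Littlewood functions are $Q_\lambda(t)=\prod_{1\le i<j\le l}\frac{1-R_{ij}}{1-tR_{ij}}\,q_{\lambda_1}\cdots q_{\lambda_l}$, where the raising operator $R_{ij}$ adds $1$ to the $i$-th index and subtracts $1$ from the $j$-th, and $P_\lambda(t)=b_\lambda(t)^{-1}Q_\lambda(t)$ with $b_\lambda(t)=\prod_{i\ge1}\prod_{j=1}^{m_i(\lambda)}(1-t^j)$. For partitions $\lambda,\mu$ of $n$ the Green polynomial $X^\lambda_\mu(t)$ is the coefficient in $p_\mu=\sum_{\lambda\vdash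 n}X^\lambda_\mu(t)P_\lambda(t)$ over $\mathbb Q(t)$. Write $\lambda^{[i]}=(\lambda_{i+1},\dots,\lambda_l)$. A subpartition $\tau\lhd\sigma$ is $\tau=(\sigma_{i_1},\dots,\sigma_{i_s})$ for an index set $i_1<\dots<i_s$ (possibly empty); in the sum below different index sets count separately. The union $\tau\cup\rho$ is the partition formed by all parts of $\tau$ and $\rho$. **Theorem.** Let $\lambda,\mu$ be partitions of the same integer $n\ge0$. Then $X^\lambda_\mu(t)$ is well defined, it is a polynomial in $t$ with rational coefficients, and $$X^\lambda_\mu(t)=\sum_{(\rho^i),(\tau^i)}\ \prod_{j=1}^{l(\lambda)-1}\frac{(-1)^{l(\rho^j)}}{z_{\rho^j}(t)},$$ where the sum runs over all sequences of $l(\lambda)-1$ pairs of partitions $(\rho^i,\tau^i)$, $1\le i\le l(\lambda)-1$, such that $|\tau^i|\le|\lambda^{[i]}|$, $\tau^i\lhd\tau^{i-1}\cup\rho^{i-1}$ and $\rho^i\vdash|\lambda^{[i]}|-|\tau^i|$, with $\tau^0\cup\rho^0=\mu$ (for $l(\lambda)\le1$ the sum is $1$). In particular, at $t=0$ the same sum,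 with each $z_{\rho^j}(t)$ replaced by $z_{\rho^j}$, equals $X^\lambda_\mu(0)=\chi^\lambda_\mu$, where the numbers $\chi^\lambda_\mu$ are the (unique) coefficients in Frobenius' formula $p_\mu=\sum_{\lambda\vdash n}\chi^\lambda_\mu s_\lambda$ in terms of the Schur functions $s_\lambda=\det(h_{\lambda_i-i+j})$, with $h_m$ the complete homogeneous symmetric functions ($h_m=0$ for $m<0$), that is, the values of the irreducible characters of the symmetric group $S_n$ on cycle type $\mu$. -/

import Mathlib

noncomputable section

namespace HallLittlewood

/-! Symmetric functions with coefficients in a field `K`, in the countably many variables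
`x₀, x₁, x₂, …`, are realised as formal power series, `MvPowerSeries ℕ K`. -/

open scoped Classical in
/-- The power sum `p_k = ∑ᵢ xᵢ ^ k` (for `k ≥ 1`) in infinitely many variables. -/
def psum (K : Type*) [Field K] (k : ℕ) : MvPowerSeries ℕ K :=
  fun e => if ∃ i : ℕ, e = Finsupp.single i k then 1 else 0

/-- `p_ρ = ∏ᵢ p_{ρᵢ}`. -/
def psumPart (K : Type*) [Field K] (ρ : Multiset ℕ) : MvPowerSeries ℕ K :=
  (ρ.map (psum K)).prod

/-- `z_ρ = ∏ᵢ i ^ mᵢ * mᵢ!`, where `mᵢ` is the multiplicity of `i` in `ρ`. -/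
def zNum (ρ : Multiset ℕ) : ℕ :=
  ∏ i ∈ ρ.toFinset, i ^ ρ.count i * (ρ.count i).factorial

/-- `z_ρ(t) = z_ρ / ∏ᵢ (1 - t ^ ρᵢ)`. -/
def z {K : Type*} [Field K] (t : K) (ρ : Multiset ℕ) : K :=
  (zNum ρ : K) / (ρ.map fun i => 1 - t ^ i).prod

/-- The one-row Hall–Littlewood function `q_m = ∑_{ρ ⊢ m} z_ρ(t)⁻¹ p_ρ` for `m ≥ 0`, and
`q_m = 0` for `m < 0`. -/
def q {K : Type*} [Field K] (t : K) (m : ℤ) : MvPowerSeries ℕ K :=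
  if m < 0 then 0 else ∑ ρ : m.toNat.Partition, (z t ρ.parts)⁻¹ • psumPart K ρ.parts

/-- The parts of a partition, listed in weakly decreasing order. -/
def rows {n : ℕ} (lam : n.Partition) : List ℕ := lam.parts.sort (· ≥ ·)

/-- The number of parts of a partition. -/
def len {n : ℕ} (lam : n.Partition) : ℕ := (rows lam).length

/-- The pairs `i < j` of rows of `lam`, indexing the raising operators `R_{ij}`. -/
abbrev RowPair {n : ℕ} (lam : n.Partition) : Type :=
  {p : Fin (len lam) × Fin (len lam) // p.1 < p.2}

/-- The `i`-th entry of the integer vector `(∏_{j<k} R_{jk} ^ e_{jk}) lam`, where `R_{jk}` adds `1`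
to the `j`-th entry and subtracts `1` from the `k`-th entry. -/
def raise {n : ℕ} (lam : n.Partition) (e : RowPair lam → ℕ) (i : Fin (len lam)) : ℤ :=
  ((rows lam).get i : ℤ) + ∑ p : RowPair lam,
    ((if p.1.1 = i then (e p : ℤ) else 0) - (if p.1.2 = i then (e p : ℤ) else 0))

/-- The coefficient of `R ^ k` in `(1 - R) / (1 - t R) = 1 + ∑_{k ≥ 1} (t ^ k - t ^ (k - 1)) R ^ k`.
-/
def raiseCoeff {K : Type*} [Field K] (t : K) (k : ℕ) : K :=
  if k = 0 then 1 else t ^ k - t ^ (k - 1)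

/-- The term of `∏_{i<j} (1 - R_{ij}) / (1 - t R_{ij}) q_lam` with the monomial
`∏_{i<j} R_{ij} ^ e_{ij}`. -/
def raiseTerm {K : Type*} [Field K] (t : K) {n : ℕ} (lam : n.Partition)
    (e : RowPair lam → ℕ) : MvPowerSeries ℕ K :=
  (∏ p, raiseCoeff t (e p)) • ∏ i, q t (raise lam e i)

/-- Only finitely many monomials in the raising operators contribute. -/
theorem finite_support_raiseTerm {K : Type*} [Field K] (t : K) {n : ℕ} (lam : n.Partition) :
    (Function.support (raiseTerm t lam)).Finite := by
  classical
  have key : ∀ e ∈ Function.support (raiseTerm t lam), ∀ i, 0 ≤ raise lam e i := by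
    intro e he i
    by_contra hi
    have h0 : q t (raise lam e i) = 0 := if_pos (not_le.mp hi)
    have h1 : ∏ i, q t (raise lam e i) = 0 := Finset.prod_eq_zero (Finset.mem_univ i) h0
    have h2 : raiseTerm t lam e = 0 := by
      unfold raiseTerm
      rw [h1]
      exact smul_zero _
    exact Function.mem_support.mp he h2
  refine (Set.Finite.pi' (ι := RowPair lam) (κ := fun _ => ℕ)
    (fun _ => Set.finite_Iic (∑ i, (rows lam).get i))).subset ?_
  intro e he p₀
  rw [Set.mem_Iic]
  have hsum : 0 ≤ ∑ i ∈ Finset.univ.filter (p₀.1.2 ≤ ·), raise lam e i :=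
    Finset.sum_nonneg fun i _ => key e he i
  simp only [raise, Finset.sum_add_distrib] at hsum
  rw [Finset.sum_comm] at hsum
  simp only [Finset.sum_sub_distrib, Finset.sum_ite_eq, Finset.mem_filter, Finset.mem_univ,
    true_and] at hsum
  rw [← Finset.sum_sub_distrib] at hsum
  have h1 : ∑ p : RowPair lam, ((if p₀.1.2 ≤ p.1.1 then (e p : ℤ) else 0) -
      (if p₀.1.2 ≤ p.1.2 then (e p : ℤ) else 0)) ≤ -(e p₀ : ℤ) := by
    have hp : ∀ p : RowPair lam, ((if p₀.1.2 ≤ p.1.1 then (e p : ℤ) else 0) -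
        (if p₀.1.2 ≤ p.1.2 then (e p : ℤ) else 0)) ≤ if p = p₀ then -(e p₀ : ℤ) else 0 := by
      intro p
      by_cases h : p = p₀
      · rw [h, if_neg (not_le.mpr p₀.2), if_pos le_rfl, if_pos rfl, zero_sub]
      · rw [if_neg h]
        by_cases h2 : p₀.1.2 ≤ p.1.1
        · rw [if_pos h2, if_pos (h2.trans p.2.le), sub_self]
        · rw [if_neg h2, zero_sub, neg_nonpos]
          split_ifs
          · exact Int.natCast_nonneg _
          · exact le_rfl
    refine (Finset.sum_le_sum fun p _ => hp p).trans ?_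
    simp
  have h2 : ∑ i ∈ Finset.univ.filter (p₀.1.2 ≤ ·), ((rows lam).get i : ℤ) ≤
      ∑ i, ((rows lam).get i : ℤ) :=
    Finset.sum_le_sum_of_subset_of_nonneg (Finset.subset_univ _) fun i _ _ => Int.natCast_nonneg _
  have h3 : (e p₀ : ℤ) ≤ ∑ i, ((rows lam).get i : ℤ) := by linarith
  exact_mod_cast h3

/-- The Hall–Littlewood function
`Q_lam(t) = ∏_{i<j} (1 - R_{ij}) / (1 - t R_{ij}) q_{lam_1} q_{lam_2} ⋯`. -/
def hallQ {K : Type*} [Field K] (t : K) {n : ℕ} (lam : n.Partition) : MvPowerSeries ℕ K :=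
  ∑ e ∈ (finite_support_raiseTerm t lam).toFinset, raiseTerm t lam e

/-- `b_lam(t) = ∏ᵢ (1 - t) (1 - t ^ 2) ⋯ (1 - t ^ mᵢ)`, where `mᵢ` is the multiplicity of `i`
in `lam`. -/
def b {K : Type*} [Field K] (t : K) {n : ℕ} (lam : n.Partition) : K :=
  ∏ i ∈ lam.parts.toFinset, ∏ j ∈ Finset.Icc 1 (lam.parts.count i), (1 - t ^ j)

/-- The Hall–Littlewood function `P_lam(t) = b_lam(t)⁻¹ Q_lam(t)`. -/
def hallP {K : Type*} [Field K] (t : K) {n : ℕ} (lam : n.Partition) : MvPowerSeries ℕ K :=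
  (b t lam)⁻¹ • hallQ t lam

/-- `X` is the family `(X^lam_mu(t))_lam` of Green polynomials attached to `mu`: the coefficients
in the expansion `p_mu = ∑_lam X^lam_mu(t) P_lam(t)`, over the field `ℚ(t)`. -/
def IsGreen {n : ℕ} (mu : n.Partition) (X : n.Partition → RatFunc ℚ) : Prop :=
  psumPart (RatFunc ℚ) mu.parts = ∑ lam : n.Partition, X lam • hallP RatFunc.X lam

open scoped Classical in
/-- The complete homogeneous symmetric function `h_m`, the sum of all monomials of degree `m`
(zero for `m < 0`). -/
def hsymm (K : Type*) [Field K] (m : ℤ) : MvPowerSeries ℕ K :=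
  fun e => if (e.degree : ℤ) = m then 1 else 0

/-- The Schur function `s_lam = det (h_{lam_i - i + j})`. -/
def schur (K : Type*) [Field K] {n : ℕ} (lam : n.Partition) : MvPowerSeries ℕ K :=
  (Matrix.of fun i j : Fin (len lam) =>
    hsymm K (((rows lam).get i : ℤ) - (i : ℤ) + (j : ℤ))).det

/-- `chi` is the family `(χ^lam_mu)_lam` of values of the irreducible characters of the symmetric
group at cycle type `mu`, as given by Frobenius: `p_mu = ∑_lam χ^lam_mu s_lam`. -/
def IsFrobenius {n : ℕ} (mu : n.Partition) (chi : n.Partition → ℚ) : Prop :=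
  psumPart ℚ mu.parts = ∑ lam : n.Partition, chi lam • schur ℚ lam

/-- `|lam^[i]|`, where `lam^[i] = (lam_{i+1}, lam_{i+2}, …)`. -/
def tailWeight {n : ℕ} (lam : n.Partition) (i : ℕ) : ℕ := ((rows lam).drop i).sum

/-- The pairs of partitions `(τ, ρ)` with `|τ| ≤ N` and `ρ ⊢ N - |τ|`. -/
abbrev PartPair (N : ℕ) : Type :=
  Σ k : Fin (N + 1), Nat.Partition (k : ℕ) × Nat.Partition (N - k)

/-- The parts of `τ`. -/
def PartPair.tau {N : ℕ} (s : PartPair N) : Multiset ℕ := s.2.1.parts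

/-- The parts of `ρ`. -/
def PartPair.rho {N : ℕ} (s : PartPair N) : Multiset ℕ := s.2.2.parts

/-- The sequences `(τ^1, ρ^1), …, (τ^{l-1}, ρ^{l-1})`, `l = l(lam)`, of pairs of partitions with
`|τ^i| ≤ |lam^[i]|` and `ρ^i ⊢ |lam^[i]| - |τ^i|`. The index `i : Fin (l - 1)` starts at `0` and
stands for `i + 1`. -/
abbrev PairSeq {n : ℕ} (lam : n.Partition) : Type :=
  (i : Fin (len lam - 1)) → PartPair (tailWeight lam (i + 1))

/-- The sequence `τ^0 ∪ ρ^0 = mu, τ^1 ∪ ρ^1, τ^2 ∪ ρ^2, …, τ^{l-1} ∪ ρ^{l-1}`. -/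
def unions {n : ℕ} (lam mu : n.Partition) (s : PairSeq lam) : Fin (len lam - 1 + 1) → Multiset ℕ :=
  Fin.cons mu.parts fun j => (s j).tau + (s j).rho

/-- The number of ways to choose `τ` as a subpartition of `σ`, i.e. of index sets
`i₁ < i₂ < ⋯ < i_s` with `τ = (σ_{i₁}, …, σ_{i_s})`. It is zero if `τ` is not a subpartition
of `σ`. -/
def subCount (τ σ : Multiset ℕ) : ℕ := (Multiset.powerset σ).count τ

/-- The sum, over all sequences of pairs `(τ^i, ρ^i)`, `1 ≤ i ≤ l(lam) - 1`, with
`|τ^i| ≤ |lam^[i]|`, `τ^i ◁ τ^{i-1} ∪ ρ^{i-1}` and `ρ^i ⊢ |lam^[i]| - |τ^i|`, where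
`τ^0 ∪ ρ^0 = mu`, of `∏_j (-1)^{l(ρ^j)} / z_{ρ^j}(t)`. Subpartitions are counted with the number
of their index sets. -/
def greenSum {K : Type*} [Field K] (t : K) {n : ℕ} (lam mu : n.Partition) : K :=
  ∑ s : PairSeq lam,
    ((∏ j, subCount (s j).tau (unions lam mu s j.castSucc) : ℕ) : K) *
      ∏ j, (-1) ^ (Multiset.card (s j).rho) / z t (s j).rho

end HallLittlewood

end

/-! ### Partitions as multisets, and the recursion for `zNum`. -/

noncomputable section

namespace HallLittlewood

/-! Hall–Littlewood functions are built by vertex operators on the polynomial ring in the power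
sums. Let H_n (`creation`) be the coefficient of z^n in the substitution p_k ↦ p_k - z^{-k} followed
by multiplication by exp(∑ (1-t^k) p_k z^k/k) = ∑ q_n z^n, and A_m (`annihilation`) the coefficient
of z^{-m} in p_k ↦ p_k + z^{-k} followed by multiplication by the inverse series.

Three facts carry the proof. First, Q_λ = H_{λ_1} ⋯ H_{λ_l} 1: the substitution in H_n multiplies
the generating series of the q's by a factor (1-R)/(1-tR), with R = uz and u = z^{-1} of the outer
operator, so it acts as a product of raising operators (`exists_creationList_eq_sum`, `hallQ_eq`).

Second, a quadratic relation between A_m and H_n (`annihilation_creation_relation`) implies that f ↦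
(constant term of A_{λ_l} ⋯ A_{λ_1} f) sends Q_μ to b_λ(t) if λ = μ and to 0 otherwise
(`annihilationList_creationList`). This functional therefore reads off the coefficient of P_λ.

Third, A_m sends p_σ to the sum, over subpartitions τ of σ, of p_τ times a coefficient of the
inverse series, and that coefficient is ∑ (-1)^{l(ρ)} z_ρ(t)^{-1} p_ρ. Iterating over the parts of λ
gives exactly the sum of the theorem (`annihilationList_varProd`).

Existence and uniqueness are linear algebra: the square matrix of the functionals on the p_ρ is
inverse to the matrix expanding P_λ in the p_ρ, and the p_ρ are linearly independent as power
series. At t = 0, q_m is h_m and the iterated creation operators become Jacobi–Trudi determinants,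
so the same equivalence gives Frobenius' formula. -/

/-- The parts of the partitions of `n`, as a finite set of multisets. -/
def partsFinset (n : ℕ) : Finset (Multiset ℕ) :=
  Finset.univ.image fun p : n.Partition => p.parts

theorem mem_partsFinset {n : ℕ} {s : Multiset ℕ} :
    s ∈ partsFinset n ↔ (∀ i ∈ s, 0 < i) ∧ s.sum = n := by
  simp only [partsFinset, Finset.mem_image, Finset.mem_univ, true_and]
  constructor
  · rintro ⟨p, rfl⟩
    exact ⟨fun i hi => p.parts_pos hi, p.parts_sum⟩
  · rintro ⟨h1, h2⟩
    exact ⟨⟨s, fun {i} hi => h1 i hi, h2⟩, rfl⟩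

theorem sum_partition {M : Type*} [AddCommMonoid M] (n : ℕ) (f : Multiset ℕ → M) :
    ∑ p : n.Partition, f p.parts = ∑ s ∈ partsFinset n, f s := by
  rw [partsFinset, Finset.sum_image]
  intro p _ p' _ h
  exact Nat.Partition.ext h

theorem partsFinset_zero : partsFinset 0 = {0} := by
  ext s
  rw [mem_partsFinset, Finset.mem_singleton]
  constructor
  · rintro ⟨h1, h2⟩
    refine Multiset.eq_zero_of_forall_notMem fun i hi => ?_
    have := Multiset.sum_eq_zero_iff.mp h2 i hi
    exact (h1 i hi).ne' this
  · rintro rfl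
    simp

theorem zNum_eq_prod (s : Multiset ℕ) (T : Finset ℕ) (hT : s.toFinset ⊆ T) :
    zNum s = ∏ i ∈ T, i ^ s.count i * (s.count i).factorial := by
  refine Finset.prod_subset hT fun i _ hi => ?_
  rw [Multiset.mem_toFinset] at hi
  simp [Multiset.count_eq_zero_of_notMem hi]

theorem zNum_cons (k : ℕ) (s : Multiset ℕ) :
    zNum (k ::ₘ s) = k * (s.count k + 1) * zNum s := by
  have hk : k ∈ insert k s.toFinset := Finset.mem_insert_self _ _
  rw [zNum_eq_prod (k ::ₘ s) (insert k s.toFinset) (by simp),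
    zNum_eq_prod s (insert k s.toFinset) (Finset.subset_insert _ _),
    ← Finset.mul_prod_erase _ _ hk, ← Finset.mul_prod_erase _ _ hk, ← mul_assoc]
  congr 1
  · rw [Multiset.count_cons_self, pow_succ, Nat.factorial_succ]
    ring
  · refine Finset.prod_congr rfl fun i hi => ?_
    rw [Multiset.count_cons_of_ne (Finset.ne_of_mem_erase hi)]

@[simp] theorem zNum_zero : zNum 0 = 1 := by simp [zNum]

/-! ### Exponential series and Newton's recursion. -/

section ExpSeries

open PowerSeries

variable (K : Type*) [Field K] {A B : Type*} [CommRing A] [Algebra K A] [CommRing B] [Algebra K B]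

/-- `z_ρ⁻¹ ∏ᵢ a_{ρᵢ}`. -/
def expTerm (a : ℕ → A) (s : Multiset ℕ) : A := (zNum s : K)⁻¹ • (s.map a).prod

/-- The power series `∑ₙ (∑_{ρ ⊢ n} z_ρ⁻¹ a_ρ) Xⁿ`, which is `exp (∑_{k ≥ 1} a_k X^k / k)`. -/
def expSeries (a : ℕ → A) : A⟦X⟧ :=
  PowerSeries.mk fun n => ∑ s ∈ partsFinset n, expTerm K a s

/-- The power series `∑_{k ≥ 1} a_k X^k`. -/
def tailSeries (a : ℕ → A) : A⟦X⟧ := PowerSeries.mk fun k => if k = 0 then 0 else a k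

theorem count_smul_expTerm_cons [CharZero K] (a : ℕ → A) {k : ℕ} (hk : 0 < k) (s : Multiset ℕ) :
    ((k ::ₘ s).count k * k) • expTerm K a (k ::ₘ s) = a k * expTerm K a s := by
  have hk' : (k : K) ≠ 0 := by exact_mod_cast hk.ne'
  have hc : ((s.count k : K) + 1) ≠ 0 := Nat.cast_add_one_ne_zero _
  rw [expTerm, expTerm, zNum_cons, Multiset.count_cons_self, Multiset.map_cons,
    Multiset.prod_cons, mul_smul_comm, ← Nat.cast_smul_eq_nsmul K, smul_smul]
  congr 1
  push_cast
  rw [mul_inv, ← mul_assoc, mul_comm ((s.count k : K) + 1), mul_inv_cancel₀ (mul_ne_zero hk' hc),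
    one_mul]

/-- Write n as the sum of k m_k over the distinct parts k of a partition. Since z_{k ∪ s} = k m_k(k
∪ s) z_s, the factor k m_k cancels when one part k is removed, and removal is a bijection onto pairs
of a k with 0 < k ≤ n and a partition of n - k. -/
theorem coeff_expSeries_newton [CharZero K] (a : ℕ → A) (n : ℕ) :
    n • coeff n (expSeries K a) =
      ∑ k ∈ Finset.range (n + 1), (if k = 0 then 0 else a k) * coeff (n - k) (expSeries K a) := by
  simp only [expSeries, coeff_mk]
  rw [Finset.smul_sum]
  have h1 : ∀ s ∈ partsFinset n, n • expTerm K a s =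
      ∑ k ∈ s.toFinset, a k * expTerm K a (s.erase k) := by
    intro s hs
    rw [mem_partsFinset] at hs
    conv_lhs => rw [← hs.2, Finset.sum_multiset_count, Finset.sum_smul]
    refine Finset.sum_congr rfl fun k hk => ?_
    rw [Multiset.mem_toFinset] at hk
    rw [← count_smul_expTerm_cons K a (hs.1 k hk), Multiset.cons_erase hk, smul_eq_mul]
  have h2 : ∀ k ∈ Finset.range (n + 1), (if k = 0 then 0 else a k) *
      ∑ s ∈ partsFinset (n - k), expTerm K a s =
      if k ≠ 0 then ∑ s ∈ partsFinset (n - k), a k * expTerm K a s else 0 := by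
    intro k _
    by_cases h : k = 0
    · simp [h]
    · simp [h, Finset.mul_sum]
  rw [Finset.sum_congr rfl h1, Finset.sum_congr rfl h2, ← Finset.sum_filter, Finset.sum_sigma',
    Finset.sum_sigma']
  refine Finset.sum_bij' (fun x _ => ⟨x.2, x.1.erase x.2⟩) (fun y _ => ⟨y.1 ::ₘ y.2, y.1⟩)
    ?_ ?_ ?_ ?_ ?_
  · rintro ⟨s, k⟩ h
    simp only [Finset.mem_sigma, mem_partsFinset, Multiset.mem_toFinset] at h
    obtain ⟨⟨hpos, hsum⟩, hk⟩ := h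
    have := Multiset.sum_erase hk
    simp only [Finset.mem_sigma, Finset.mem_filter, Finset.mem_range, mem_partsFinset]
    exact ⟨⟨by omega, (hpos k hk).ne'⟩, fun i hi => hpos i (Multiset.mem_of_mem_erase hi),
      by omega⟩
  · rintro ⟨k, s⟩ h
    simp only [Finset.mem_sigma, Finset.mem_filter, Finset.mem_range, mem_partsFinset] at h
    simp only [Finset.mem_sigma, mem_partsFinset, Multiset.mem_toFinset, Multiset.sum_cons]
    refine ⟨⟨?_, by omega⟩, Multiset.mem_cons_self _ _⟩
    intro i hi
    rcases Multiset.mem_cons.mp hi with rfl | hi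
    · omega
    · exact h.2.1 i hi
  · rintro ⟨s, k⟩ h
    simp only [Finset.mem_sigma, Multiset.mem_toFinset] at h
    simp [Multiset.cons_erase h.2]
  · rintro ⟨k, s⟩ _
    simp
  · rintro ⟨s, k⟩ _
    rfl

theorem coeff_zero_expSeries (a : ℕ → A) : coeff 0 (expSeries K a) = 1 := by
  simp [expSeries, partsFinset_zero, expTerm]

theorem coeff_tailSeries_mul (a : ℕ → A) (F : A⟦X⟧) (n : ℕ) :
    coeff n (tailSeries a * F) =
      ∑ k ∈ Finset.range (n + 1), (if k = 0 then 0 else a k) * coeff (n - k) F := by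
  rw [coeff_mul, Finset.Nat.sum_antidiagonal_eq_sum_range_succ
    fun i j => coeff i (tailSeries a) * coeff j F]
  simp [tailSeries]

theorem coeff_X_mul_derivative (F : A⟦X⟧) (n : ℕ) :
    coeff n (X * derivative A F) = n • coeff n F := by
  cases n with
  | zero => simp
  | succ n =>
    rw [coeff_succ_X_mul, coeff_derivative, nsmul_eq_mul]
    push_cast
    ring

theorem X_mul_derivative_expSeries [CharZero K] (a : ℕ → A) :
    X * derivative A (expSeries K a) = tailSeries a * expSeries K a := by
  ext n
  rw [coeff_X_mul_derivative, coeff_tailSeries_mul, coeff_expSeries_newton]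

/-- `expSeries K a` is the only solution of `X F' = (∑_{k ≥ 1} a_k X^k) F` with constant term `1`,
coefficientwise. -/
theorem coeff_eq_coeff_expSeries [CharZero K] {a : ℕ → A} {f : ℕ → A} (h0 : f 0 = 1)
    (h : ∀ n, n • f n = ∑ k ∈ Finset.range (n + 1), (if k = 0 then 0 else a k) * f (n - k))
    (n : ℕ) : f n = coeff n (expSeries K a) := by
  induction n using Nat.strong_induction_on with
  | _ n ih =>
    rcases Nat.eq_zero_or_pos n with rfl | hn
    · rw [h0, coeff_zero_expSeries]
    · have h1 : n • f n = n • coeff n (expSeries K a) := by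
        rw [h, coeff_expSeries_newton]
        refine Finset.sum_congr rfl fun k _ => ?_
        by_cases hk : k = 0
        · simp [hk]
        · rw [ih (n - k) (by omega)]
      rw [← Nat.cast_smul_eq_nsmul K, ← Nat.cast_smul_eq_nsmul K] at h1
      have hn' : (n : K) ≠ 0 := by exact_mod_cast hn.ne'
      exact smul_right_injective A hn' h1

theorem eq_expSeries [CharZero K] {a : ℕ → A} {F : A⟦X⟧} (h0 : coeff 0 F = 1)
    (h : X * derivative A F = tailSeries a * F) : F = expSeries K a := by
  ext n
  refine coeff_eq_coeff_expSeries K (f := fun n => coeff n F) h0 (fun n => ?_) n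
  rw [← coeff_X_mul_derivative, h, coeff_tailSeries_mul]

/-- By the Leibniz rule the product solves the differential equation that characterises the left
side. -/
theorem expSeries_add [CharZero K] (a a' : ℕ → A) :
    expSeries K (a + a') = expSeries K a * expSeries K a' := by
  symm
  apply eq_expSeries
  · simp [coeff_mul, -coeff_zero_eq_constantCoeff, coeff_zero_expSeries]
  · have hadd : tailSeries (a + a') = tailSeries a + tailSeries a' := by
      ext k
      by_cases hk : k = 0 <;> simp [tailSeries, hk]
    rw [Derivation.leibniz, hadd, smul_eq_mul, smul_eq_mul]
    linear_combination expSeries K a * X_mul_derivative_expSeries K a' +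
      expSeries K a' * X_mul_derivative_expSeries K a

theorem expSeries_zero [CharZero K] : expSeries K (0 : ℕ → A) = 1 := by
  symm
  apply eq_expSeries
  · simp
  · have h : tailSeries (0 : ℕ → A) = 0 := by
      ext k
      simp [tailSeries]
    simp [h]

theorem expSeries_mul_neg [CharZero K] (a : ℕ → A) : expSeries K a * expSeries K (-a) = 1 := by
  rw [← expSeries_add, add_neg_cancel, expSeries_zero]

theorem tailSeries_pow (c : A) :
    tailSeries (fun k => c ^ k) * (1 - C c * X) = C c * X := by
  rw [mul_sub, mul_one]
  ext n
  rw [map_sub, mul_left_comm, coeff_C_mul, coeff_C_mul]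
  rcases n with _ | _ | n
  · simp [tailSeries]
  · simp [tailSeries, coeff_succ_mul_X]
  · simp [tailSeries, coeff_succ_mul_X, coeff_X, pow_succ', ← mul_assoc]

/-- This is exp(log(1 - cX)). It turns shifts of the power sums into rational factors. -/
theorem expSeries_neg_pow [CharZero K] (c : A) :
    expSeries K (-fun k => c ^ k) = 1 - C c * X := by
  symm
  apply eq_expSeries
  · simp
  · have h : tailSeries (-fun k => c ^ k) = -tailSeries (fun k => c ^ k) := by
      ext k
      by_cases hk : k = 0 <;> simp [tailSeries, hk]
    rw [h, neg_mul, tailSeries_pow]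
    simp [Derivation.leibniz, mul_comm]

variable {K} in
theorem map_expTerm (φ : A →ₐ[K] B) (a : ℕ → A) (s : Multiset ℕ) :
    φ (expTerm K a s) = expTerm K (fun k => φ (a k)) s := by
  rw [expTerm, expTerm, map_smul, map_multiset_prod, Multiset.map_map]
  rfl

variable {K} in
theorem map_expSeries (φ : A →ₐ[K] B) (a : ℕ → A) :
    PowerSeries.map (φ : A →+* B) (expSeries K a) = expSeries K (fun k => φ (a k)) := by
  ext n
  simp only [expSeries, coeff_map, coeff_mk, map_sum]
  exact Finset.sum_congr rfl fun s _ => map_expTerm φ a s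

theorem expTerm_congr {a a' : ℕ → A} {s : Multiset ℕ} (hs : ∀ i ∈ s, a i = a' i) :
    expTerm K a s = expTerm K a' s := by
  rw [expTerm, expTerm, Multiset.map_congr rfl hs]

theorem expSeries_congr {a a' : ℕ → A} (h : ∀ i, 0 < i → a i = a' i) :
    expSeries K a = expSeries K a' := by
  ext n
  simp only [expSeries, coeff_mk]
  refine Finset.sum_congr rfl fun s hs => expTerm_congr K fun i hi => h i ?_
  exact (mem_partsFinset.mp hs).1 i hi

end ExpSeries

/-! ### Coefficients with integer index, zero for negative index. -/

section IntCoeff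

open PowerSeries

variable {A B : Type*} [CommRing A] [CommRing B]

/-- The coefficients of a power series, indexed by the integers. -/
def intCoeff (F : A⟦X⟧) (m : ℤ) : A := if m < 0 then 0 else coeff m.toNat F

theorem intCoeff_natCast (F : A⟦X⟧) (n : ℕ) : intCoeff F n = coeff n F := by
  simp [intCoeff]

theorem intCoeff_of_neg (F : A⟦X⟧) {m : ℤ} (hm : m < 0) : intCoeff F m = 0 := if_pos hm

theorem map_intCoeff (φ : A →+* B) (F : A⟦X⟧) (m : ℤ) :
    φ (intCoeff F m) = intCoeff (PowerSeries.map φ F) m := by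
  unfold intCoeff
  split_ifs <;> simp

theorem intCoeff_mul_one_sub (F : A⟦X⟧) (c : A) (m : ℤ) :
    intCoeff (F * (1 - C c * X)) m = intCoeff F m - c * intCoeff F (m - 1) := by
  rcases lt_trichotomy m 0 with h | rfl | h
  · rw [intCoeff_of_neg _ h, intCoeff_of_neg _ h, intCoeff_of_neg _ (by omega)]
    simp
  · rw [intCoeff_of_neg _ (show (0 : ℤ) - 1 < 0 by omega)]
    simp [intCoeff]
  · obtain ⟨n, rfl⟩ : ∃ n : ℕ, m = ((n + 1 : ℕ) : ℤ) := ⟨(m - 1).toNat, by omega⟩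
    have h1 : (((n + 1 : ℕ) : ℤ) - 1) = (n : ℤ) := by push_cast; ring
    rw [h1, intCoeff_natCast, intCoeff_natCast, intCoeff_natCast, mul_sub, mul_one, map_sub,
      mul_left_comm, coeff_C_mul, coeff_succ_mul_X]

end IntCoeff

/-- The polynomial ring in variables standing for the power sums `p_k`. -/
abbrev PowerSumRing (K : Type*) [Field K] : Type _ := MvPolynomial ℕ K

local notation "V" => PowerSumRing

/-! ### Vertex operators on polynomials in the power sums. -/

section Operators

variable {K : Type*} [Field K]

/-- The algebra homomorphism `p_k ↦ p_k + s u ^ k`, where `u` is a new variable. -/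
def shift (s : K) : V K →ₐ[K] Polynomial (V K) :=
  MvPolynomial.aeval fun k => Polynomial.C (MvPolynomial.X k) + s • Polynomial.X ^ k

theorem shift_X (s : K) (k : ℕ) :
    shift s (MvPolynomial.X k) = Polynomial.C (MvPolynomial.X k) + s • Polynomial.X ^ k :=
  MvPolynomial.aeval_X _ _

/-- The generating series `exp (ε ∑_k (1 - t ^ k) p_k z ^ k / k)`; for `ε = 1` it is `∑ q_n z ^ n`,
for `ε = -1` its inverse. -/
def halfSeries (t ε : K) : PowerSeries (V K) :=
  expSeries K fun k => (ε * (1 - t ^ k)) • (MvPolynomial.X k : V K)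

/-- The coefficients of `halfSeries`. -/
def halfCoeff (t ε : K) (m : ℤ) : V K := intCoeff (halfSeries t ε) m

section HalfSeries

variable (t : K) {ε s : K}

theorem halfCoeff_of_neg {m : ℤ} (hm : m < 0) : halfCoeff t ε m = 0 := intCoeff_of_neg _ hm

theorem halfCoeff_zero : halfCoeff t ε 0 = 1 := by
  have := coeff_zero_expSeries K fun k => (ε * (1 - t ^ k)) • (MvPolynomial.X k : V K)
  simpa [halfCoeff, intCoeff, halfSeries] using this

theorem map_C_halfSeries :
    PowerSeries.map (Polynomial.C : V K →+* _) (halfSeries t ε) =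
      expSeries K fun k => (ε * (1 - t ^ k)) • Polynomial.C (MvPolynomial.X k : V K) := by
  have := map_expSeries (K := K) (IsScalarTower.toAlgHom K (V K) (Polynomial (V K)))
    fun k => (ε * (1 - t ^ k)) • (MvPolynomial.X k : V K)
  simp only [map_smul] at this
  exact this

theorem map_shift_halfSeries :
    PowerSeries.map (shift s : V K →+* _) (halfSeries t ε) =
      expSeries K ((fun k => (ε * (1 - t ^ k)) • Polynomial.C (MvPolynomial.X k : V K)) +
        fun k => (ε * s) • (Polynomial.X ^ k - (t • Polynomial.X) ^ k)) := by
  rw [halfSeries, map_expSeries]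
  congr 1
  ext1 k
  simp only [map_smul, shift_X, Pi.add_apply, smul_add, smul_sub, smul_pow, smul_smul]
  rw [← sub_smul]
  ring_nf

variable [CharZero K]

theorem halfSeries_mul_halfSeries : halfSeries t 1 * halfSeries t (-1) = 1 := by
  rw [halfSeries, halfSeries, ← expSeries_mul_neg K fun k => (1 * (1 - t ^ k)) •
    (MvPolynomial.X k : V K)]
  congr 2
  ext1 k
  simp only [Pi.neg_apply]
  rw [← neg_smul, neg_mul]

/-- The shift multiplies the series by exp(∑ (1-t^k) u^k z^k/k) = (1 - tuz)/(1 - uz); the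
denominator is cleared. For `ε * s = -1` the inverse factor appears. -/
theorem map_shift_halfSeries_of_eq_one (h : ε * s = 1) :
    PowerSeries.map (shift s : V K →+* _) (halfSeries t ε) *
        (1 - PowerSeries.C Polynomial.X * PowerSeries.X) =
      PowerSeries.map (Polynomial.C : V K →+* _) (halfSeries t ε) *
        (1 - PowerSeries.C (t • Polynomial.X) * PowerSeries.X) := by
  rw [map_shift_halfSeries, map_C_halfSeries, h, ← expSeries_neg_pow K, ← expSeries_neg_pow K,
    ← expSeries_add, ← expSeries_add]
  congr 1
  ext1 k
  simp only [Pi.add_apply, Pi.neg_apply, one_smul]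
  ring

theorem map_shift_halfSeries_of_eq_neg_one (h : ε * s = -1) :
    PowerSeries.map (shift s : V K →+* _) (halfSeries t ε) *
        (1 - PowerSeries.C (t • Polynomial.X) * PowerSeries.X) =
      PowerSeries.map (Polynomial.C : V K →+* _) (halfSeries t ε) *
        (1 - PowerSeries.C Polynomial.X * PowerSeries.X) := by
  rw [map_shift_halfSeries, map_C_halfSeries, h, ← expSeries_neg_pow K, ← expSeries_neg_pow K,
    ← expSeries_add, ← expSeries_add]
  congr 1
  ext1 k
  simp only [Pi.add_apply, Pi.neg_apply, neg_smul, one_smul]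
  ring

theorem shift_halfCoeff_of_eq_one (h : ε * s = 1) (m : ℤ) :
    shift s (halfCoeff t ε m) = Polynomial.X * shift s (halfCoeff t ε (m - 1)) +
      (Polynomial.C (halfCoeff t ε m) -
        Polynomial.X * Polynomial.C (t • halfCoeff t ε (m - 1))) := by
  have h1 := congrArg (fun F => intCoeff F m) (map_shift_halfSeries_of_eq_one t h)
  simp only [intCoeff_mul_one_sub, ← map_intCoeff] at h1
  change shift s (halfCoeff t ε m) - Polynomial.X * shift s (halfCoeff t ε (m - 1)) =
    Polynomial.C (halfCoeff t ε m) - t • Polynomial.X * Polynomial.C (halfCoeff t ε (m - 1)) at h1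
  rw [← Polynomial.smul_C]
  rw [smul_mul_assoc, ← mul_smul_comm] at h1
  linear_combination h1

theorem shift_halfCoeff_of_eq_neg_one (h : ε * s = -1) (m : ℤ) :
    shift s (halfCoeff t ε m) = t • (Polynomial.X * shift s (halfCoeff t ε (m - 1))) +
      (Polynomial.C (halfCoeff t ε m) - Polynomial.X * Polynomial.C (halfCoeff t ε (m - 1))) := by
  have h1 := congrArg (fun F => intCoeff F m) (map_shift_halfSeries_of_eq_neg_one t h)
  simp only [intCoeff_mul_one_sub, ← map_intCoeff] at h1
  change shift s (halfCoeff t ε m) - t • Polynomial.X * shift s (halfCoeff t ε (m - 1)) =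
    Polynomial.C (halfCoeff t ε m) - Polynomial.X * Polynomial.C (halfCoeff t ε (m - 1)) at h1
  rw [smul_mul_assoc] at h1
  linear_combination h1

theorem coeff_shift_halfCoeff_of_eq_one (h : ε * s = 1) (m : ℤ) (k : ℕ) :
    (shift s (halfCoeff t ε m)).coeff k =
      (if k = 0 then 1 else 1 - t) • halfCoeff t ε (m - k) := by
  induction k generalizing m with
  | zero => rw [shift_halfCoeff_of_eq_one t h]; simp
  | succ k ih =>
    rw [shift_halfCoeff_of_eq_one t h, Polynomial.coeff_add, Polynomial.coeff_sub,
      Polynomial.coeff_X_mul, Polynomial.coeff_X_mul, ih, Polynomial.coeff_C_succ]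
    rcases k with _ | k
    · simp [sub_smul, ← sub_eq_add_neg]
    · simp only [Polynomial.coeff_C_succ, Nat.succ_ne_zero, if_false, sub_zero, add_zero]
      push_cast
      congr 2
      ring

/-- These are the coefficients of (1 - uz)/(1 - tuz). This is where the raising operators come from.
-/
theorem coeff_shift_halfCoeff_of_eq_neg_one (h : ε * s = -1) (m : ℤ) (k : ℕ) :
    (shift s (halfCoeff t ε m)).coeff k = raiseCoeff t k • halfCoeff t ε (m - k) := by
  induction k generalizing m with
  | zero => rw [shift_halfCoeff_of_eq_neg_one t h]; simp [raiseCoeff]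
  | succ k ih =>
    rw [shift_halfCoeff_of_eq_neg_one t h, Polynomial.coeff_add, Polynomial.coeff_sub,
      Polynomial.coeff_smul, Polynomial.coeff_X_mul, Polynomial.coeff_X_mul, ih,
      Polynomial.coeff_C_succ, smul_smul]
    rcases k with _ | k
    · simp [sub_smul, ← sub_eq_add_neg, raiseCoeff]
    · simp only [Polynomial.coeff_C_succ, sub_zero, add_zero, raiseCoeff, Nat.succ_ne_zero,
        if_false, Nat.add_sub_cancel]
      push_cast
      congr 2 <;> ring

end HalfSeries

/-- The linear map on polynomials in `u` with `u ^ k ↦ g k`. -/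
def evalSeq (g : ℕ → V K) : Polynomial (V K) →ₗ[V K] V K :=
  Polynomial.lsum fun k => LinearMap.mulLeft (V K) (g k)

theorem evalSeq_apply (g : ℕ → V K) (P : Polynomial (V K)) :
    evalSeq g P = P.sum fun k c => g k * c := rfl

theorem evalSeq_eq_sum (g : ℕ → V K) {P : Polynomial (V K)} {D : ℕ}
    (hD : ∀ k, D ≤ k → P.coeff k = 0) :
    evalSeq g P = ∑ k ∈ Finset.range D, g k * P.coeff k := by
  rw [evalSeq_apply, Polynomial.sum_def]
  refine Finset.sum_subset ?_ ?_
  · intro k hk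
    rw [Polynomial.mem_support_iff] at hk
    rw [Finset.mem_range]
    by_contra h
    exact hk (hD k (not_lt.mp h))
  · intro k _ hk
    rw [Polynomial.notMem_support_iff.mp hk, mul_zero]

theorem evalSeq_C (g : ℕ → V K) (c : V K) : evalSeq g (Polynomial.C c) = g 0 * c := by
  rw [evalSeq_apply, Polynomial.sum_C_index (by simp)]

theorem evalSeq_C_mul (g : ℕ → V K) (c : V K) (P : Polynomial (V K)) :
    evalSeq g (Polynomial.C c * P) = c * evalSeq g P := by
  rw [← Polynomial.smul_eq_C_mul, map_smul, smul_eq_mul]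

theorem evalSeq_X_pow_mul (g : ℕ → V K) (i : ℕ) (P : Polynomial (V K)) :
    evalSeq g (Polynomial.X ^ i * P) = evalSeq (fun k => g (k + i)) P := by
  have hP : ∀ k, P.natDegree + 1 ≤ k → P.coeff k = 0 := fun k hk =>
    Polynomial.coeff_eq_zero_of_natDegree_lt hk
  have hXP : ∀ k, i + (P.natDegree + 1) ≤ k → (Polynomial.X ^ i * P).coeff k = 0 := by
    intro k hk
    rw [Polynomial.coeff_X_pow_mul', if_pos (by omega), hP _ (by omega)]
  rw [evalSeq_eq_sum _ hP, evalSeq_eq_sum _ hXP, Finset.sum_range_add, Finset.sum_eq_zero, zero_add]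
  · refine Finset.sum_congr rfl fun k _ => ?_
    rw [add_comm i k, Polynomial.coeff_X_pow_mul]
  · intro k hk
    rw [Polynomial.coeff_X_pow_mul', if_neg (by simpa using hk), mul_zero]

/-- The operator `f ↦ ∑_k c_{m + k} f_k`, where `∑_k f_k u ^ k = shift s f` and `c` are the
coefficients of `halfSeries t ε`. -/
def vertexOp (t ε s : K) (m : ℤ) : V K →ₗ[K] V K :=
  (evalSeq fun k => halfCoeff t ε (m + k)).restrictScalars K ∘ₗ (shift s).toLinearMap

section VertexOp

variable (t : K) {ε s : K} (m : ℤ)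

theorem vertexOp_apply (f : V K) :
    vertexOp t ε s m f = evalSeq (fun k => halfCoeff t ε (m + k)) (shift s f) := rfl

theorem vertexOp_one : vertexOp t ε s m 1 = halfCoeff t ε m := by
  rw [vertexOp_apply, map_one, ← Polynomial.C_1, evalSeq_C]
  simp

theorem evalSeq_X_mul_halfCoeff (P : Polynomial (V K)) :
    evalSeq (fun k => halfCoeff t ε (m + k)) (Polynomial.X * P) =
      evalSeq (fun k => halfCoeff t ε (m + 1 + k)) P := by
  rw [← pow_one Polynomial.X, evalSeq_X_pow_mul]
  congr 2
  ext1 k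
  push_cast
  ring_nf

/-- The shift sends p_i to p_i + s u^i, and a factor u^i moves the index by i. This lets identities
between the operators be proved by induction on the polynomial they act on. -/
theorem vertexOp_mul_X (f : V K) (i : ℕ) :
    vertexOp t ε s m (f * MvPolynomial.X i) =
      MvPolynomial.X i * vertexOp t ε s m f + s • vertexOp t ε s (m + i) f := by
  rw [vertexOp_apply, map_mul, shift_X, mul_comm, add_mul, map_add, evalSeq_C_mul, smul_mul_assoc,
    LinearMap.map_smul_of_tower, evalSeq_X_pow_mul, vertexOp_apply, vertexOp_apply]
  congr 4
  ext1 k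
  push_cast
  ring_nf

theorem vertexOp_halfCoeff_mul [CharZero K] {ε' : K} (h : ε' * s = 1) (N : ℤ) (g : V K) :
    vertexOp t ε s m (halfCoeff t ε' N * g) =
      vertexOp t ε s (m + 1) (halfCoeff t ε' (N - 1) * g) +
        (halfCoeff t ε' N * vertexOp t ε s m g -
          t • (halfCoeff t ε' (N - 1) * vertexOp t ε s (m + 1) g)) := by
  rw [vertexOp_apply, map_mul, shift_halfCoeff_of_eq_one t h, add_mul, sub_mul, map_add, map_sub,
    mul_assoc, mul_assoc, evalSeq_X_mul_halfCoeff, evalSeq_X_mul_halfCoeff, evalSeq_C_mul,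
    evalSeq_C_mul, vertexOp_apply, vertexOp_apply, vertexOp_apply, map_mul (shift s),
    smul_mul_assoc]

end VertexOp

/-- The creation operator, with `Q_λ = H_{λ_1} H_{λ_2} ⋯ 1`. -/
def creation (t : K) (n : ℤ) : V K →ₗ[K] V K := vertexOp t 1 (-1) n

/-- The annihilation operator, adjoint to `creation`. -/
def annihilation (t : K) (m : ℤ) : V K →ₗ[K] V K := vertexOp t (-1) 1 (-m)

/-! ### Commutation of creation and annihilation operators. -/

section Commutation

variable (t : K)

theorem creation_one (n : ℤ) : creation t n 1 = halfCoeff t 1 n := vertexOp_one t n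

theorem annihilation_one (m : ℤ) : annihilation t m 1 = halfCoeff t (-1) (-m) := vertexOp_one t _

theorem creation_mul_X (n : ℤ) (f : V K) (i : ℕ) :
    creation t n (f * MvPolynomial.X i) =
      MvPolynomial.X i * creation t n f - creation t (n + i) f := by
  rw [creation, vertexOp_mul_X, neg_one_smul, sub_eq_add_neg]
  rfl

theorem annihilation_mul_X (m : ℤ) (f : V K) (i : ℕ) :
    annihilation t m (f * MvPolynomial.X i) =
      MvPolynomial.X i * annihilation t m f + annihilation t (m - i) f := by
  rw [annihilation, annihilation, vertexOp_mul_X, one_smul, neg_sub, sub_eq_neg_add]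

variable [CharZero K]

theorem annihilation_halfCoeff (m n : ℤ) :
    annihilation t (m + 1) (halfCoeff t 1 (n + 1)) = annihilation t m (halfCoeff t 1 n) +
      (halfCoeff t 1 (n + 1) * halfCoeff t (-1) (-(m + 1)) -
        t • (halfCoeff t 1 n * halfCoeff t (-1) (-m))) := by
  have h := vertexOp_halfCoeff_mul t (ε := -1) (s := 1) (-(m + 1)) (ε' := 1) (one_mul 1) (n + 1) 1
  rw [mul_one, mul_one, vertexOp_one, vertexOp_one, add_sub_cancel_right,
    show -(m + 1) + 1 = -m by ring] at h
  exact h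

theorem creation_halfCoeff (m n : ℤ) :
    creation t n (halfCoeff t (-1) (-m)) = creation t (n + 1) (halfCoeff t (-1) (-(m + 1))) +
      (halfCoeff t (-1) (-m) * halfCoeff t 1 n -
        t • (halfCoeff t (-1) (-(m + 1)) * halfCoeff t 1 (n + 1))) := by
  have h := vertexOp_halfCoeff_mul t (ε := 1) (s := -1) n (ε' := -1) (by ring) (-m) 1
  rw [mul_one, mul_one, vertexOp_one, vertexOp_one, show -m - 1 = -(m + 1) by ring] at h
  exact h

/-- For 1 ≤ m ≤ n only powers u^k with k ≥ m contribute, all with the same factor 1 - t. The rest is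
the coefficient of z^(n-m) in a product of inverse series. -/
theorem annihilation_creation_one {m n : ℤ} (hm : 1 ≤ m) :
    annihilation t m (creation t n 1) = if m = n then (1 - t) • 1 else 0 := by
  rw [creation_one]
  rcases lt_or_ge n m with hn | hn
  · rw [if_neg hn.ne', annihilation, vertexOp_apply,
      evalSeq_eq_sum (D := (n + 1).toNat) _ fun k hk => ?_]
    · refine Finset.sum_eq_zero fun k hk => ?_
      rw [Finset.mem_range] at hk
      rw [halfCoeff_of_neg t (by omega), zero_mul]
    · rw [coeff_shift_halfCoeff_of_eq_one t (one_mul 1), halfCoeff_of_neg t (by omega), smul_zero]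
  · obtain ⟨m, rfl⟩ := Int.eq_ofNat_of_zero_le (show 0 ≤ m by omega)
    obtain ⟨r, rfl⟩ : ∃ r : ℕ, n = m + r := ⟨(n - m).toNat, by omega⟩
    rw [annihilation, vertexOp_apply, evalSeq_eq_sum (D := m + (r + 1)) _ fun k hk => ?_]
    · rw [Finset.sum_range_add, Finset.sum_eq_zero, zero_add]
      · have h1 := congrArg (PowerSeries.coeff r) (halfSeries_mul_halfSeries t)
        rw [mul_comm, PowerSeries.coeff_mul, Finset.Nat.sum_antidiagonal_eq_sum_range_succ
          fun i j => PowerSeries.coeff i (halfSeries t (-1)) *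
            PowerSeries.coeff j (halfSeries t 1), PowerSeries.coeff_one] at h1
        have h2 : ∀ i ∈ Finset.range (r + 1), halfCoeff t (-1) (-(m : ℤ) + (m + i : ℕ)) *
            (shift 1 (halfCoeff t 1 ((m : ℤ) + r))).coeff (m + i) =
            (1 - t) • (PowerSeries.coeff i (halfSeries t (-1)) *
            PowerSeries.coeff (r - i) (halfSeries t 1)) := by
          intro i hi
          rw [Finset.mem_range] at hi
          rw [coeff_shift_halfCoeff_of_eq_one t (one_mul 1), if_neg (by omega), mul_smul_comm,
            ← intCoeff_natCast, ← intCoeff_natCast]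
          rw [show -(m : ℤ) + (m + i : ℕ) = (i : ℤ) by push_cast; ring,
            show (m : ℤ) + r - (m + i : ℕ) = (r - i : ℕ) by omega]
          rfl
        rw [Finset.sum_congr rfl h2, ← Finset.smul_sum, h1]
        by_cases hr : r = 0 <;> simp [hr]
      · intro k hk
        rw [Finset.mem_range] at hk
        rw [halfCoeff_of_neg t (by omega), zero_mul]
    · rw [coeff_shift_halfCoeff_of_eq_one t (one_mul 1), halfCoeff_of_neg t (by omega), smul_zero]

/-- Multiplying f by p_i adds the terms A_{m-i} H_n f - A_m H_{n+i} f, which cancel once the indices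
are large. The bound grows by i. -/
theorem exists_annihilation_creation (f : V K) : ∃ B : ℤ, ∀ m n, B ≤ m → B ≤ n →
    annihilation t m (creation t n f) = if m = n then (1 - t) • f else 0 := by
  induction f using MvPolynomial.induction_on with
  | C a =>
    refine ⟨1, fun m n hm _ => ?_⟩
    rw [← mul_one (MvPolynomial.C a), ← MvPolynomial.smul_eq_C_mul, map_smul, map_smul,
      annihilation_creation_one t hm]
    split_ifs
    · rw [smul_comm]
    · rw [smul_zero]
  | add f g hf hg =>
    obtain ⟨B, hB⟩ := hf
    obtain ⟨B', hB'⟩ := hg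
    refine ⟨max B B', fun m n hm hn => ?_⟩
    rw [map_add, map_add, hB m n (le_of_max_le_left hm) (le_of_max_le_left hn),
      hB' m n (le_of_max_le_right hm) (le_of_max_le_right hn)]
    split_ifs
    · rw [smul_add]
    · rw [add_zero]
  | mul_X f i hf =>
    obtain ⟨B, hB⟩ := hf
    refine ⟨B + i, fun m n hm hn => ?_⟩
    rw [creation_mul_X, map_sub, mul_comm, annihilation_mul_X, hB m n (by omega) (by omega),
      hB (m - i) n (by omega) (by omega), hB m (n + i) (by omega) (by omega)]
    by_cases h : m = n
    · simp [h, mul_comm]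
    · rw [if_neg h]
      by_cases h' : m - i = n
      · rw [if_pos h', if_pos (by omega)]
        simp [h]
      · rw [if_neg h', if_neg (by omega)]
        simp [h]

/-- The sum of the two products on the vacuum, up to the normally ordered terms. -/
theorem annihilation_add_creation (m n : ℤ) :
    annihilation t m (halfCoeff t 1 n) + creation t (n + 1) (halfCoeff t (-1) (-(m + 1))) -
      t • (halfCoeff t 1 n * halfCoeff t (-1) (-m) +
        halfCoeff t 1 (n + 1) * halfCoeff t (-1) (-(m + 1))) =
      if m = n then (1 - t) • 1 else 0 := by
  -- The two recursions make the left side invariant under (m, n) ↦ (m+1, n+1). After k such moves m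
  -- is positive, and all terms but the first vanish because of negative indices.
  have key : ∀ k : ℕ, ∀ m n : ℤ, 1 ≤ m + k →
      annihilation t m (halfCoeff t 1 n) + creation t (n + 1) (halfCoeff t (-1) (-(m + 1))) -
        t • (halfCoeff t 1 n * halfCoeff t (-1) (-m) +
          halfCoeff t 1 (n + 1) * halfCoeff t (-1) (-(m + 1))) =
        if m = n then (1 - t) • 1 else 0 := by
    intro k
    induction k with
    | zero =>
      intro m n hm
      have h := annihilation_creation_one t (m := m) (n := n) (by simpa using hm)
      rw [creation_one] at h
      rw [h, halfCoeff_of_neg t (m := -m) (by omega),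
        halfCoeff_of_neg t (m := -(m + 1)) (by omega)]
      simp
    | succ k ih =>
      intro m n hm
      have h := ih (m + 1) (n + 1) (by push_cast at hm; omega)
      rw [annihilation_halfCoeff] at h
      rw [creation_halfCoeff]
      simp only [add_left_inj] at h
      rw [← h]
      simp only [smul_add, mul_comm (halfCoeff t (-1) _)]
      abel
  exact key (1 - m).toNat m n (by omega)

/-- The commutation relation of the creation and annihilation operators. -/
theorem annihilation_creation_relation (m n : ℤ) (f : V K) :
    annihilation t m (creation t n f) - t • annihilation t (m + 1) (creation t (n + 1) f) +
      creation t (n + 1) (annihilation t (m + 1) f) - t • creation t n (annihilation t m f) =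
      if m = n then ((1 - t) ^ 2) • f else 0 := by
  induction f using MvPolynomial.induction_on generalizing m n with
  | C a =>
    have h1 : annihilation t m (creation t n 1) -
        t • annihilation t (m + 1) (creation t (n + 1) 1) +
        creation t (n + 1) (annihilation t (m + 1) 1) - t • creation t n (annihilation t m 1) =
        if m = n then ((1 - t) ^ 2) • 1 else 0 := by
      have h := annihilation_add_creation t m n
      simp only [creation_one, annihilation_one]
      rw [annihilation_halfCoeff, creation_halfCoeff t m n]
      have h2 : (if m = n then ((1 - t) ^ 2) • 1 else 0 : V K) =
          (1 - t) • (if m = n then (1 - t) • 1 else 0) := by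
        split_ifs
        · rw [smul_smul, sq]
        · rw [smul_zero]
      rw [h2, ← h]
      simp only [MvPolynomial.smul_eq_C_mul, map_sub, map_one]
      ring
    rw [← mul_one (MvPolynomial.C a), ← MvPolynomial.smul_eq_C_mul]
    simp only [map_smul]
    rw [smul_comm t a, smul_comm t a, ← smul_sub, ← smul_add, ← smul_sub, h1]
    split_ifs
    · rw [smul_comm]
    · rw [smul_zero]
  | add f g hf hg =>
    have h : (if m = n then ((1 - t) ^ 2) • (f + g) else 0 : V K) =
        (if m = n then ((1 - t) ^ 2) • f else 0) + if m = n then ((1 - t) ^ 2) • g else 0 := by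
      split_ifs
      · rw [smul_add]
      · rw [add_zero]
    rw [h, ← hf, ← hg]
    simp only [map_add, smul_add]
    abel
  | mul_X f i hf =>
    have h1 := hf m n
    have h2 := hf (m - i) n
    have h3 := hf m (n + i)
    -- Multiplication by p_i adds the relation at (m-i, n) minus the relation at (m, n+i). Their
    -- right sides agree.
    have h4 : (if m - i = n then ((1 - t) ^ 2) • f else 0 : V K) =
        if m = n + i then ((1 - t) ^ 2) • f else 0 := if_congr (by omega) rfl rfl
    have h5 : (if m = n then ((1 - t) ^ 2) • (f * MvPolynomial.X i) else 0 : V K) =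
        MvPolynomial.X i * if m = n then ((1 - t) ^ 2) • f else 0 := by
      split_ifs
      · rw [mul_smul_comm, mul_comm]
      · rw [mul_zero]
    rw [h5, ← h1]
    simp only [creation_mul_X, annihilation_mul_X, map_sub, map_add,
      mul_comm (MvPolynomial.X i : V K)]
    rw [h4, ← h3, show m - i + 1 = m + 1 - i by ring, show n + i + 1 = n + 1 + i by ring] at h2
    simp only [MvPolynomial.smul_eq_C_mul] at h2 ⊢
    linear_combination h2

/-- The relation expresses A_m H_n through A_{m+1} H_{n+1}. When φ kills every term H_{n+b+1}
A_{m+b+1} f, descending from large indices, where `exists_annihilation_creation` applies, gives a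
closed formula without infinite sums. -/
theorem apply_annihilation_creation {M : Type*} [AddCommGroup M] [Module K M] (φ : V K →ₗ[K] M)
    (m n : ℤ) (f : V K)
    (h : ∀ b : ℕ, φ (creation t (n + (b + 1)) (annihilation t (m + (b + 1)) f)) = 0) :
    φ (annihilation t m (creation t n f)) =
      (if m = n then (1 - t) • φ f else 0) + t • φ (creation t n (annihilation t m f)) := by
  obtain ⟨B, hB⟩ := exists_annihilation_creation t f
  have hrel : ∀ m n, φ (annihilation t m (creation t n f)) =
      t • φ (annihilation t (m + 1) (creation t (n + 1) f)) -
      φ (creation t (n + 1) (annihilation t (m + 1) f)) +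
      t • φ (creation t n (annihilation t m f)) +
      if m = n then ((1 - t) ^ 2) • φ f else 0 := by
    intro m n
    have h1 := congrArg φ (annihilation_creation_relation t m n f)
    have h2 : φ (if m = n then ((1 - t) ^ 2) • f else 0) =
        if m = n then ((1 - t) ^ 2) • φ f else 0 := by
      split_ifs
      · rw [map_smul]
      · rw [map_zero]
    rw [h2] at h1
    rw [← h1]
    simp only [map_add, map_sub, map_smul]
    abel
  -- 1 - t is a fixed point of x ↦ t x + (1-t)^2, so the value passes unchanged through each descent
  -- step.
  have hδ : (if m = n then (1 - t) • φ f else 0) =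
      t • (if m = n then (1 - t) • φ f else 0) + if m = n then ((1 - t) ^ 2) • φ f else 0 := by
    split_ifs
    · rw [smul_smul, ← add_smul]
      congr 1
      ring
    · rw [smul_zero, add_zero]
  have key : ∀ d b : ℕ, B ≤ m + (b + d) → B ≤ n + (b + d) →
      φ (annihilation t (m + (b + 1)) (creation t (n + (b + 1)) f)) =
        if m = n then (1 - t) • φ f else 0 := by
    intro d
    induction d with
    | zero =>
      intro b hm hn
      rw [hB _ _ (by push_cast at hm; omega) (by push_cast at hn; omega)]
      by_cases hmn : m = n
      · rw [if_pos (by omega), if_pos hmn, map_smul]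
      · rw [if_neg (by omega), if_neg hmn, map_zero]
    | succ d ih =>
      intro b hm hn
      have h1 := ih (b + 1) (by push_cast at hm ⊢; omega) (by push_cast at hn ⊢; omega)
      have h2 := h (b + 1)
      push_cast at h1 h2
      rw [hrel, h b, add_assoc m, add_assoc n, h1, h2, smul_zero, sub_zero, add_zero]
      conv_rhs => rw [hδ]
      congr 1
      exact if_congr (by omega) rfl rfl
  have h0 := key ((B - m).toNat + (B - n).toNat) 0 (by omega) (by omega)
  have h1 := h 0
  simp only [Nat.cast_zero, zero_add] at h0 h1
  rw [hrel, h0, h1, sub_zero]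
  conv_rhs => rw [hδ]
  abel

end Commutation

end Operators

/-! ### Orthogonality of annihilation functionals and Hall–Littlewood functions. -/

section Orthogonality

variable {K : Type*} [Field K] (t : K)

/-- The linear functional taking the constant term. -/
def vacuum : V K →ₗ[K] K := (MvPolynomial.aeval (0 : ℕ → K)).toLinearMap

theorem vacuum_mul (f g : V K) : vacuum (f * g) = vacuum f * vacuum g := by
  simp [vacuum]

theorem vacuum_one : vacuum (1 : V K) = 1 := by
  simp [vacuum]

/-- The iterated creation operators applied to `1`. -/
def creationList : List ℕ → V K
  | [] => 1
  | a :: R => creation t a (creationList R)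

/-- The functional obtained by applying annihilation operators and then taking the constant term. -/
def annihilationList : List ℕ → V K →ₗ[K] K
  | [] => vacuum
  | a :: R => annihilationList R ∘ₗ annihilation t a

/-- The normalisation `∏ᵢ (1 - t) ⋯ (1 - t ^ mᵢ)` of a multiset with multiplicities `mᵢ`. -/
def bMultiset (s : Multiset ℕ) : K :=
  ∏ i ∈ s.toFinset, ∏ j ∈ Finset.Icc 1 (s.count i), (1 - t ^ j)

theorem bMultiset_eq_prod (s : Multiset ℕ) (T : Finset ℕ) (hT : s.toFinset ⊆ T) :
    bMultiset t s = ∏ i ∈ T, ∏ j ∈ Finset.Icc 1 (s.count i), (1 - t ^ j) := by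
  refine Finset.prod_subset hT fun i _ hi => ?_
  rw [Multiset.mem_toFinset] at hi
  simp [Multiset.count_eq_zero_of_notMem hi]

theorem bMultiset_cons (k : ℕ) (s : Multiset ℕ) :
    bMultiset t (k ::ₘ s) = (1 - t ^ (k ::ₘ s).count k) * bMultiset t s := by
  have hk : k ∈ insert k s.toFinset := Finset.mem_insert_self _ _
  rw [bMultiset_eq_prod t (k ::ₘ s) (insert k s.toFinset) (by simp),
    bMultiset_eq_prod t s (insert k s.toFinset) (Finset.subset_insert _ _),
    ← Finset.mul_prod_erase _ _ hk, ← Finset.mul_prod_erase _ _ hk, ← mul_assoc]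
  congr 1
  · rw [Multiset.count_cons_self, Finset.prod_Icc_succ_top (by omega), mul_comm]
  · refine Finset.prod_congr rfl fun i hi => ?_
    rw [Multiset.count_cons_of_ne (Finset.ne_of_mem_erase hi)]

theorem bMultiset_ne_zero (ht : ∀ k, 0 < k → t ^ k ≠ 1) (s : Multiset ℕ) : bMultiset t s ≠ 0 := by
  refine Finset.prod_ne_zero_iff.mpr fun i _ => Finset.prod_ne_zero_iff.mpr fun j hj => ?_
  exact sub_ne_zero.mpr (ht j (Finset.mem_Icc.mp hj).1).symm

variable [CharZero K]

theorem vacuum_halfCoeff (ε : K) (m : ℤ) :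
    vacuum (halfCoeff t ε m) = if m = 0 then 1 else 0 := by
  have h : PowerSeries.map ((MvPolynomial.aeval (0 : ℕ → K) : V K →ₐ[K] K) : V K →+* K)
      (halfSeries t ε) = 1 := by
    rw [halfSeries, map_expSeries, ← expSeries_zero K]
    congr 1
    ext1 k
    simp
  have h' := map_intCoeff ((MvPolynomial.aeval (0 : ℕ → K) : V K →ₐ[K] K) : V K →+* K)
    (halfSeries t ε) m
  rw [h] at h'
  refine Eq.trans h' ?_
  rcases lt_trichotomy m 0 with hm | rfl | hm
  · rw [intCoeff_of_neg _ hm, if_neg hm.ne]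
  · simp [intCoeff]
  · rw [if_neg hm.ne', intCoeff, if_neg hm.not_gt, PowerSeries.coeff_one, if_neg (by omega)]

theorem vacuum_creation {n : ℤ} (hn : 0 < n) (f : V K) : vacuum (creation t n f) = 0 := by
  rw [creation, vertexOp_apply, evalSeq_apply, Polynomial.sum_def, map_sum]
  refine Finset.sum_eq_zero fun k _ => ?_
  rw [vacuum_mul, vacuum_halfCoeff, if_neg (by omega), zero_mul]

/-- A_m can be moved past each H_n with n < m, with no diagonal term, until it meets 1, which it
kills because -m < 0. -/
theorem annihilation_creationList_of_lt {m : ℤ} (hm : 0 < m) {R : List ℕ}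
    (hR : ∀ x ∈ R, (x : ℤ) < m) : annihilation t m (creationList t R) = 0 := by
  induction R generalizing m with
  | nil =>
    rw [creationList, annihilation_one, halfCoeff_of_neg t (by omega)]
  | cons n R ih =>
    have hR' : ∀ b : ℕ, annihilation t (m + b) (creationList t R) = 0 := fun b =>
      ih (by omega) fun x hx => (hR x (List.mem_cons_of_mem _ hx)).trans_le (by omega)
    have hn := hR n List.mem_cons_self
    have h := apply_annihilation_creation t LinearMap.id m n (creationList t R) fun b => by
      have := hR' (b + 1)
      push_cast at this
      rw [this, map_zero, map_zero]
    have h0 := hR' 0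
    simp only [Nat.cast_zero, add_zero] at h0
    rw [if_neg hn.ne', h0, map_zero, map_zero, smul_zero, add_zero] at h
    exact h

/-- Each further copy of m replaces the factor x by (1 - t) + t x, which takes 1 - t^c to 1 -
t^(c+1). This is how b_λ(t) builds up. -/
theorem annihilation_creationList_cons {m : ℕ} (hm : 0 < m) {R : List ℕ}
    (hR : (m :: R).Pairwise (· ≥ ·)) :
    annihilation t m (creationList t (m :: R)) =
      (1 - t ^ (m :: R).count m) • creationList t R := by
  induction R with
  | nil =>
    have h := apply_annihilation_creation t LinearMap.id m m (creationList t []) fun b => by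
      rw [annihilation_creationList_of_lt t (by omega) (by simp), map_zero, map_zero]
    rw [annihilation_creationList_of_lt t (by omega) (by simp)] at h
    change annihilation t m (creation t m (creationList t [])) = _
    simpa using h
  | cons n R ih =>
    have hle : ∀ x ∈ n :: R, x ≤ m := (List.pairwise_cons.mp hR).1
    have h := apply_annihilation_creation t LinearMap.id m m (creationList t (n :: R)) fun b => by
      rw [annihilation_creationList_of_lt t (by omega) fun x hx => ?_, map_zero, map_zero]
      have := hle x hx
      omega
    rw [if_pos rfl] at h
    simp only [LinearMap.id_apply] at h
    rw [creationList, h]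
    rcases (hle n List.mem_cons_self).eq_or_lt with rfl | hlt
    · rw [ih hR.of_cons, map_smul, List.count_cons_self, smul_smul,
        show creation t n (creationList t R) = creationList t (n :: R) from rfl, ← add_smul]
      congr 1
      simp only [List.count_cons_self]
      ring
    · have hlt' : ∀ x ∈ n :: R, x < m := by
        intro x hx
        rcases List.mem_cons.mp hx with rfl | hx
        · exact hlt
        · exact ((List.pairwise_cons.mp hR.of_cons).1 x hx).trans_lt hlt
      rw [annihilation_creationList_of_lt t (by omega) fun x hx => by exact_mod_cast hlt' x hx,
        map_zero, smul_zero, add_zero, List.count_cons_self, List.count_eq_zero_of_not_mem]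
      · simp
      · exact fun hmem => (hlt' m hmem).false

/-- Dual to `annihilation_creationList_of_lt`: H_n is moved outwards past the smaller A_m, until the
constant term, which is zero for n > 0, is taken. -/
theorem annihilationList_creation_of_lt {n : ℤ} (hn : 0 < n) {R : List ℕ}
    (hR : ∀ x ∈ R, (x : ℤ) < n) (f : V K) : annihilationList t R (creation t n f) = 0 := by
  induction R generalizing n f with
  | nil => exact vacuum_creation t hn f
  | cons m R ih =>
    have hR' : ∀ b : ℕ, ∀ g, annihilationList t R (creation t (n + b) g) = 0 := fun b g =>
      ih (by omega) (fun x hx => (hR x (List.mem_cons_of_mem _ hx)).trans_le (by omega)) g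
    have hm := hR m List.mem_cons_self
    have h := apply_annihilation_creation t (annihilationList t R) m n f fun b => by
      exact_mod_cast hR' (b + 1) _
    have h0 := hR' 0 (annihilation t m f)
    simp only [Nat.cast_zero, add_zero] at h0
    rw [if_neg hm.ne, h0, smul_zero, add_zero] at h
    exact h

/-- The dual orthogonality of the annihilation functionals and the Hall–Littlewood functions. -/
theorem annihilationList_creationList {R S : List ℕ} (hR : R.Pairwise (· ≥ ·))
    (hS : S.Pairwise (· ≥ ·)) (hR0 : ∀ x ∈ R, 0 < x) (hS0 : ∀ x ∈ S, 0 < x) :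
    annihilationList t R (creationList t S) = if R = S then bMultiset t R else 0 := by
  induction R generalizing S with
  | nil =>
    cases S with
    | nil => simp [annihilationList, creationList, vacuum_one, bMultiset]
    | cons n S =>
      rw [if_neg (by simp)]
      have := hS0 n List.mem_cons_self
      exact annihilationList_creation_of_lt t (by omega) (by simp) _
  | cons m R ih =>
    have hm := hR0 m List.mem_cons_self
    cases S with
    | nil =>
      rw [if_neg (by simp), annihilationList, LinearMap.comp_apply,
        annihilation_creationList_of_lt t (by omega) (by simp), map_zero]
    | cons n S =>
      have hn := hS0 n List.mem_cons_self
      -- If the leading parts differ, the larger one exceeds all parts of the other list and gives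
      -- 0. If they agree, both are removed.
      rcases lt_trichotomy m n with h | rfl | h
      · rw [if_neg (by simp [h.ne])]
        refine annihilationList_creation_of_lt t (by omega) (fun x hx => ?_) _
        rcases List.mem_cons.mp hx with rfl | hx
        · exact_mod_cast h
        · exact_mod_cast ((List.pairwise_cons.mp hR).1 x hx).trans_lt h
      · rw [annihilationList, LinearMap.comp_apply, annihilation_creationList_cons t hm hS,
          map_smul, ih hR.of_cons hS.of_cons (fun x hx => hR0 x (List.mem_cons_of_mem _ hx))
            fun x hx => hS0 x (List.mem_cons_of_mem _ hx)]
        by_cases hRS : R = S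
        · subst hRS
          rw [if_pos rfl, if_pos rfl, smul_eq_mul, ← Multiset.cons_coe, bMultiset_cons]
          simp
        · rw [if_neg hRS, if_neg (by simpa using hRS), smul_zero]
      · rw [if_neg (by simp [h.ne']), annihilationList, LinearMap.comp_apply,
          annihilation_creationList_of_lt t (by omega) fun x hx => ?_, map_zero]
        rcases List.mem_cons.mp hx with rfl | hx
        · exact_mod_cast h
        · exact_mod_cast ((List.pairwise_cons.mp hS).1 x hx).trans_lt h

end Orthogonality

/-! ### Raising operators and Jacobi–Trudi determinants from creation operators. -/

section Formulas

variable {K : Type*} [Field K] (t : K)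

section Raising

/-- The pairs `i < j` of elements of `Fin l`. -/
abbrev FinPair (l : ℕ) : Type := {p : Fin l × Fin l // p.1 < p.2}

/-- The entries of `(∏_{j<k} R_{jk} ^ e_{jk}) R`. -/
def raiseList (R : List ℕ) (e : FinPair R.length → ℕ) (i : Fin R.length) : ℤ :=
  (R.get i : ℤ) + ∑ p : FinPair R.length,
    ((if p.1.1 = i then (e p : ℤ) else 0) - (if p.1.2 = i then (e p : ℤ) else 0))

/-- The pairs of `Fin (l + 1)` are those containing `0` and the shifted pairs of `Fin l`. -/
def finPairSucc (l : ℕ) : Fin l ⊕ FinPair l ≃ FinPair (l + 1) :=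
  Equiv.ofBijective
    (Sum.elim (fun j => ⟨(0, j.succ), Fin.succ_pos j⟩)
      fun p => ⟨(p.1.1.succ, p.1.2.succ), Fin.succ_lt_succ_iff.mpr p.2⟩) <| by
    constructor
    · rintro (j | ⟨⟨a, b⟩, h⟩) (j' | ⟨⟨a', b'⟩, h'⟩) hEq
      · simpa using hEq
      · exact absurd (congrArg (fun p => p.1.1) hEq) (Fin.succ_ne_zero _).symm
      · exact absurd (congrArg (fun p => p.1.1) hEq) (Fin.succ_ne_zero _)
      · simpa using hEq
    · rintro ⟨⟨a, b⟩, h⟩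
      have hb : b ≠ 0 := (Fin.pos_of_ne_zero (Fin.ne_zero_of_lt h)).ne'
      obtain ⟨b, rfl⟩ := Fin.exists_succ_eq.mpr hb
      rcases Fin.eq_zero_or_eq_succ a with rfl | ⟨a, rfl⟩
      · exact ⟨Sum.inl b, rfl⟩
      · exact ⟨Sum.inr ⟨(a, b), Fin.succ_lt_succ_iff.mp h⟩, rfl⟩

theorem finPairSucc_inl (l : ℕ) (j : Fin l) :
    (finPairSucc l (Sum.inl j)).1 = (0, j.succ) := rfl

theorem finPairSucc_inr (l : ℕ) (p : FinPair l) :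
    (finPairSucc l (Sum.inr p)).1 = (p.1.1.succ, p.1.2.succ) := rfl

/-- Exponents of the raising operators for `l + 1` rows. -/
def raiseExp (l : ℕ) : (Fin l → ℕ) × (FinPair l → ℕ) ≃ (FinPair (l + 1) → ℕ) :=
  (Equiv.sumArrowEquivProdArrow _ _ _).symm.trans (Equiv.arrowCongr (finPairSucc l) (Equiv.refl ℕ))

theorem raiseExp_inl (l : ℕ) (x : (Fin l → ℕ) × (FinPair l → ℕ)) (j : Fin l) :
    raiseExp l x (finPairSucc l (Sum.inl j)) = x.1 j := by
  simp [raiseExp, Equiv.arrowCongr]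
  rfl

theorem raiseExp_inr (l : ℕ) (x : (Fin l → ℕ) × (FinPair l → ℕ)) (p : FinPair l) :
    raiseExp l x (finPairSucc l (Sum.inr p)) = x.2 p := by
  simp [raiseExp, Equiv.arrowCongr]
  rfl

theorem sum_finPair_succ {M : Type*} [AddCommMonoid M] (l : ℕ) (f : FinPair (l + 1) → M) :
    ∑ p, f p = ∑ j, f (finPairSucc l (Sum.inl j)) + ∑ p, f (finPairSucc l (Sum.inr p)) := by
  rw [← (finPairSucc l).sum_comp, Fintype.sum_sum_type]

theorem prod_finPair_succ {M : Type*} [CommMonoid M] (l : ℕ) (f : FinPair (l + 1) → M) :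
    ∏ p, f p = (∏ j, f (finPairSucc l (Sum.inl j))) * ∏ p, f (finPairSucc l (Sum.inr p)) := by
  rw [← (finPairSucc l).prod_comp, Fintype.prod_sum_type]

theorem raiseList_cons_zero (a : ℕ) (R : List ℕ)
    (x : (Fin R.length → ℕ) × (FinPair R.length → ℕ)) :
    raiseList (a :: R) (raiseExp R.length x) 0 = a + (∑ j, x.1 j : ℕ) := by
  unfold raiseList
  refine congrArg₂ (· + ·) rfl ?_
  refine (sum_finPair_succ R.length _).trans ?_
  simp only [raiseExp_inl, raiseExp_inr]
  simp [finPairSucc_inl, finPairSucc_inr]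

theorem raiseList_cons_succ (a : ℕ) (R : List ℕ)
    (x : (Fin R.length → ℕ) × (FinPair R.length → ℕ)) (i : Fin R.length) :
    raiseList (a :: R) (raiseExp R.length x) i.succ = raiseList R x.2 i - x.1 i := by
  unfold raiseList
  rw [add_sub_assoc]
  refine congrArg₂ (· + ·) rfl ?_
  refine (sum_finPair_succ R.length _).trans ?_
  simp only [raiseExp_inl, raiseExp_inr]
  simp [finPairSucc_inl, finPairSucc_inr, (Fin.succ_ne_zero _).symm]
  ring

variable [CharZero K]

theorem shift_halfCoeff_eq_sum {m : ℤ} {M : ℕ} (hM : m < M) :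
    shift (-1) (halfCoeff t 1 m) = ∑ k ∈ Finset.range M,
      Polynomial.C (raiseCoeff t k • halfCoeff t 1 (m - k)) * Polynomial.X ^ k := by
  ext1 k
  rw [coeff_shift_halfCoeff_of_eq_neg_one t (by ring), Polynomial.finsetSum_coeff]
  simp only [Polynomial.coeff_C_mul, Polynomial.coeff_X_pow, mul_ite, mul_one, mul_zero]
  rw [Finset.sum_ite_eq]
  split_ifs with h
  · rfl
  · rw [Finset.mem_range] at h
    rw [halfCoeff_of_neg t (by omega), smul_zero]

/-- The shift is multiplicative: each factor gives up e_i with weight `raiseCoeff t (e i)`, and the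
total power of u raises n. These are the raising operators joining a new first row to the others. -/
theorem creation_prod_halfCoeff {ι : Type*} [Fintype ι] [DecidableEq ι] (n : ℤ) (a : ι → ℤ)
    {M : ℕ} (hM : ∀ i, a i < M) :
    creation t n (∏ i, halfCoeff t 1 (a i)) =
      ∑ e ∈ Fintype.piFinset fun _ : ι => Finset.range M, (∏ i, raiseCoeff t (e i)) •
        (halfCoeff t 1 (n + (∑ i, e i : ℕ)) * ∏ i, halfCoeff t 1 (a i - e i)) := by
  rw [creation, vertexOp_apply, map_prod,
    Finset.prod_congr rfl fun i _ => shift_halfCoeff_eq_sum t (hM i), Finset.prod_univ_sum, map_sum]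
  refine Finset.sum_congr rfl fun e _ => ?_
  rw [Finset.prod_mul_distrib, ← map_prod, Finset.prod_pow_eq_pow_sum, evalSeq_C_mul,
    ← mul_one (Polynomial.X ^ _), evalSeq_X_pow_mul, ← Polynomial.C_1, evalSeq_C]
  simp only [MvPolynomial.smul_eq_C_mul, Finset.prod_mul_distrib, map_prod]
  rw [zero_add]
  ring

/-- The raising operator formula for the iterated creation operators. -/
theorem exists_creationList_eq_sum (R : List ℕ) : ∃ S : Finset (FinPair R.length → ℕ),
    (∀ e, e ∉ S → ∃ i, raiseList R e i < 0) ∧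
    creationList t R = ∑ e ∈ S, (∏ p, raiseCoeff t (e p)) •
      ∏ i, halfCoeff t 1 (raiseList R e i) := by
  classical
  induction R with
  | nil =>
    have : IsEmpty (FinPair ([] : List ℕ).length) := ⟨fun p => p.1.1.elim0⟩
    have : IsEmpty (Fin ([] : List ℕ).length) := ⟨fun i => i.elim0⟩
    refine ⟨{isEmptyElim}, fun e he => absurd (Finset.mem_singleton.mpr (Subsingleton.elim _ _)) he,
      ?_⟩
    change (1 : V K) = _
    simp
  | cons a R ih =>
    obtain ⟨S, hS, hsum⟩ := ih
    -- With M above every entry occurring in S, an exponent outside `range M` makes some entry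
    -- negative.
    obtain ⟨M, hM⟩ : ∃ M : ℕ, ∀ e ∈ S, ∀ i, raiseList R e i < M := by
      refine ⟨∑ e ∈ S, ∑ i, (raiseList R e i).natAbs + 1, fun e he i => ?_⟩
      have h1 : (raiseList R e i).natAbs ≤ ∑ i, (raiseList R e i).natAbs :=
        Finset.single_le_sum (f := fun i => (raiseList R e i).natAbs) (fun _ _ => Nat.zero_le _)
          (Finset.mem_univ i)
      have h2 : ∑ i, (raiseList R e i).natAbs ≤ ∑ e ∈ S, ∑ i, (raiseList R e i).natAbs :=
        Finset.single_le_sum (f := fun e => ∑ i, (raiseList R e i).natAbs)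
          (fun _ _ => Nat.zero_le _) he
      omega
    refine ⟨((Fintype.piFinset fun _ : Fin R.length => Finset.range M) ×ˢ S).map
      (raiseExp R.length).toEmbedding, ?_, ?_⟩
    · intro e he
      obtain ⟨x, rfl⟩ := (raiseExp R.length).surjective e
      rw [← Equiv.coe_toEmbedding, Finset.mem_map', Finset.mem_product, Fintype.mem_piFinset,
        not_and_or, not_forall] at he
      by_cases hx : x.2 ∈ S
      · rcases he with ⟨i, hi⟩ | h
        · rw [Finset.mem_range] at hi
          refine ⟨i.succ, ?_⟩
          rw [raiseList_cons_succ]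
          have := hM _ hx i
          omega
        · exact absurd hx h
      · obtain ⟨i, hi⟩ := hS _ hx
        refine ⟨i.succ, ?_⟩
        rw [raiseList_cons_succ]
        omega
    · rw [creationList, hsum, map_sum, Finset.sum_map, Finset.sum_product_right]
      refine Finset.sum_congr rfl fun e he => ?_
      rw [map_smul, creation_prod_halfCoeff t a _ (hM e he), Finset.smul_sum]
      refine Finset.sum_congr rfl fun e' _ => ?_
      rw [Equiv.coe_toEmbedding, smul_smul]
      congr 1
      · refine Eq.trans ?_ (prod_finPair_succ R.length _).symm
        simp only [raiseExp_inl, raiseExp_inr]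
        rw [mul_comm]
      · refine Eq.trans ?_ (Fin.prod_univ_succ _).symm
        rw [raiseList_cons_zero]
        simp only [raiseList_cons_succ]

end Raising

section Realization

/-- The algebra homomorphism to power series taking the variables to the power sums. -/
def toSeries (K : Type*) [Field K] : V K →ₐ[K] MvPowerSeries ℕ K := MvPolynomial.aeval (psum K)

theorem toSeries_prod_X (s : Multiset ℕ) :
    toSeries K ((s.map MvPolynomial.X).prod) = psumPart K s := by
  rw [map_multiset_prod, Multiset.map_map, psumPart]
  congr 2
  ext1 k
  exact MvPolynomial.aeval_X _ _

theorem prod_map_smul {A : Type*} [CommRing A] [Algebra K A] (c : ℕ → K) (a : ℕ → A)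
    (s : Multiset ℕ) :
    (s.map fun i => c i • a i).prod = (s.map c).prod • (s.map a).prod := by
  induction s using Multiset.induction_on with
  | empty => simp
  | cons k s ih => simp [ih, smul_smul, mul_comm]

theorem toSeries_halfCoeff (m : ℤ) : toSeries K (halfCoeff t 1 m) = q t m := by
  unfold halfCoeff intCoeff q
  split_ifs
  · rw [map_zero]
  · rw [sum_partition m.toNat fun s => (z t s)⁻¹ • psumPart K s, halfSeries, expSeries,
      PowerSeries.coeff_mk, map_sum]
    refine Finset.sum_congr rfl fun s _ => ?_
    rw [expTerm, map_smul, prod_map_smul, map_smul, toSeries_prod_X, smul_smul, z, inv_div,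
      div_eq_inv_mul]
    simp

/-- The two finite index sets may differ, but a term outside either one is zero, so both sums equal
the same `finsum`. -/
theorem hallQ_eq [CharZero K] {n : ℕ} (lam : n.Partition) :
    hallQ t lam = toSeries K (creationList t (rows lam)) := by
  obtain ⟨S, hS, hsum⟩ := exists_creationList_eq_sum t (rows lam)
  have hterm : ∀ e, raiseTerm t lam e = toSeries K ((∏ p, raiseCoeff t (e p)) •
      ∏ i, halfCoeff t 1 (raiseList (rows lam) e i)) := by
    intro e
    rw [map_smul, map_prod]
    simp only [toSeries_halfCoeff]
    rfl
  rw [hsum, map_sum]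
  refine Eq.trans ?_ (Finset.sum_congr rfl fun e _ => hterm e)
  refine (finsum_eq_sum _ (finite_support_raiseTerm t lam)).symm.trans ?_
  refine finsum_eq_sum_of_support_subset _ fun e he => ?_
  by_contra h
  obtain ⟨i, hi⟩ := hS e h
  refine he ?_
  rw [hterm, Finset.prod_eq_zero (Finset.mem_univ i) (halfCoeff_of_neg t hi), smul_zero, map_zero]

end Realization

section Schur

variable [CharZero K]

/-- At `t = 0` the iterated creation operators give Jacobi–Trudi determinants. -/
theorem creationList_zero (R : List ℕ) : creationList (0 : K) R =
    (Matrix.of fun i j : Fin R.length =>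
      halfCoeff (0 : K) 1 ((R.get i : ℤ) - (i : ℤ) + (j : ℤ))).det := by
  induction R with
  | nil =>
    have : IsEmpty (Fin ([] : List ℕ).length) := ⟨fun i => i.elim0⟩
    exact (Matrix.det_isEmpty).symm
  | cons a R ih =>
    -- The first row of A holds the powers u^j, which the operator replaces by q_{a+j}; so A yields
    -- the Jacobi–Trudi matrix for a :: R. Subtracting u times the previous column gives B, whose
    -- first row is (1, 0, …, 0) and whose minor is the shift of the smaller determinant, since q_m
    -- ↦ q_m - u q_{m-1} at t = 0.
    let A : Matrix (Fin (R.length + 1)) (Fin (R.length + 1)) (Polynomial (V K)) :=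
      Matrix.of fun i j => Fin.cases (Polynomial.X ^ (j : ℕ))
        (fun i => Polynomial.C (halfCoeff (0 : K) 1 ((R.get i : ℤ) - (i + 1 : ℤ) + (j : ℤ)))) i
    let B : Matrix (Fin (R.length + 1)) (Fin (R.length + 1)) (Polynomial (V K)) :=
      Matrix.of fun i j => Fin.cases (Fin.cases 1 (fun _ => 0) j)
        (fun i => Fin.cases (A i.succ 0)
          (fun j => shift (-1) (halfCoeff (0 : K) 1 ((R.get i : ℤ) - (i : ℤ) + (j : ℤ)))) j) i
    have hAB : A.det = B.det := by
      refine Matrix.det_eq_of_forall_col_eq_smul_add_pred (fun _ => Polynomial.X) ?_ ?_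
      · intro i
        refine Fin.cases ?_ (fun i => ?_) i
        · simp [A, B]
        · simp [A, B]
      · intro i j
        refine Fin.cases ?_ (fun i => ?_) i
        · simp [A, B, pow_succ']
        · simp only [A, B, Matrix.of_apply, Fin.cases_succ, Fin.val_succ, Fin.val_castSucc]
          rw [shift_halfCoeff_of_eq_neg_one 0 (by ring), zero_smul, zero_add]
          push_cast
          rw [show ((R.get i : ℤ) - (i + 1) + (j + 1)) = (R.get i : ℤ) - i + j by ring,
            show ((R.get i : ℤ) - (i + 1) + j) = (R.get i : ℤ) - i + j - 1 by ring]
          ring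
    have hB : B.det = shift (-1) (creationList (0 : K) R) := by
      rw [ih, Matrix.det_succ_row_zero, Fin.sum_univ_succ, Finset.sum_eq_zero, AlgHom.map_det]
      · simp only [B, Matrix.of_apply, Fin.cases_zero, Fin.val_zero, pow_zero, one_mul, add_zero]
        rfl
      · intro j _
        simp [B]
    rw [creationList, creation, vertexOp_apply, ← hB, ← hAB]
    refine Eq.trans ?_ (Matrix.det_succ_row_zero _).symm
    rw [Matrix.det_succ_row_zero, map_sum]
    refine Finset.sum_congr rfl fun j _ => ?_
    have hminor : (A.submatrix Fin.succ j.succAbove).det = Polynomial.C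
        ((Matrix.of fun i j : Fin (a :: R).length =>
          halfCoeff (0 : K) 1 (((a :: R).get i : ℤ) - (i : ℤ) + (j : ℤ))).submatrix
            Fin.succ j.succAbove).det := by
      rw [RingHom.map_det]
      rfl
    have hterm : ∀ d : V K, (-1) ^ (j : ℕ) * (Polynomial.X : Polynomial (V K)) ^ (j : ℕ) *
        Polynomial.C d = Polynomial.C ((-1) ^ (j : ℕ) * d) *
          (Polynomial.X ^ (j : ℕ) * Polynomial.C 1) := by
      intro d
      simp only [map_mul, map_pow, map_neg, map_one]
      ring
    rw [hminor, show A 0 j = Polynomial.X ^ (j : ℕ) from rfl, hterm, evalSeq_C_mul,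
      evalSeq_X_pow_mul, evalSeq_C]
    simp only [Matrix.of_apply, zero_add, mul_one]
    rw [mul_right_comm]
    refine congrArg₂ (· * ·) (congrArg₂ (· * ·) rfl ?_) rfl
    simp

end Schur

end Formulas

/-! ### Annihilation operators on products of power sums. -/

section GreenPolynomials

variable {K : Type*} [Field K] (t : K)

/-- The product of the variables `p_i` over the elements of a multiset. -/
def varProd (K : Type*) [Field K] (s : Multiset ℕ) : V K := (s.map MvPolynomial.X).prod

theorem varProd_zero : varProd K 0 = 1 := by simp [varProd]

theorem varProd_add (s s' : Multiset ℕ) : varProd K (s + s') = varProd K s * varProd K s' := by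
  simp [varProd]

/-- Expand ∏ (p_k + c u^k) by choosing the factors that keep p_k. `powerset` repeats equal
submultisets, so index sets are counted separately, as `subCount` requires. -/
theorem shift_varProd (c : K) (s : Multiset ℕ) :
    shift c (varProd K s) = (s.powerset.map fun u => Polynomial.X ^ (s - u).sum *
      Polynomial.C (c ^ (Multiset.card (s - u)) • varProd K u)).sum := by
  have h : ∀ u : Multiset ℕ, (u.map fun k => c • (Polynomial.X : Polynomial (V K)) ^ k).prod =
      c ^ Multiset.card u • Polynomial.X ^ u.sum := by
    intro u
    rw [prod_map_smul, Multiset.map_const', Multiset.prod_replicate]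
    congr 1
    induction u using Multiset.induction_on with
    | empty => simp
    | cons k u ih => simp [ih, pow_add]
  rw [varProd, map_multiset_prod, Multiset.map_map]
  have h' : s.map (⇑(shift c) ∘ MvPolynomial.X) =
      s.map fun k => c • (Polynomial.X : Polynomial (V K)) ^ k +
        Polynomial.C (MvPolynomial.X k) := by
    refine Multiset.map_congr rfl fun k _ => ?_
    rw [Function.comp_apply, shift_X, add_comm]
  rw [h', Multiset.prod_map_add, Multiset.antidiagonal_eq_map_powerset, Multiset.map_map]
  refine congrArg _ (Multiset.map_congr rfl fun u _ => ?_)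
  simp only [Function.comp_apply]
  rw [h, varProd, ← Polynomial.smul_C, mul_smul_comm, smul_mul_assoc, map_multiset_prod,
    Multiset.map_map]
  rfl

theorem vertexOp_varProd (ε c : K) (m : ℤ) (s : Multiset ℕ) :
    vertexOp t ε c m (varProd K s) = (s.powerset.map fun u =>
      c ^ (Multiset.card (s - u)) • (halfCoeff t ε (m + (s - u).sum) * varProd K u)).sum := by
  rw [vertexOp_apply, shift_varProd, map_multiset_sum, Multiset.map_map]
  refine congrArg _ (Multiset.map_congr rfl fun u _ => ?_)
  rw [Function.comp_apply, evalSeq_X_pow_mul, evalSeq_C, mul_smul_comm, zero_add]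

theorem halfCoeff_natCast (ε : K) (k : ℕ) : halfCoeff t ε k = ∑ s ∈ partsFinset k,
    (ε ^ Multiset.card s / z t s) • varProd K s := by
  rw [halfCoeff, intCoeff_natCast, halfSeries, expSeries, PowerSeries.coeff_mk]
  refine Finset.sum_congr rfl fun s _ => ?_
  rw [expTerm, prod_map_smul, Multiset.prod_map_mul, Multiset.map_const', Multiset.prod_replicate,
    smul_smul, z, varProd, div_div_eq_mul_div]
  congr 1
  rw [div_eq_inv_mul]

section Span

/-- The homogeneous component of degree `n`, where `p_k` has degree `k`. -/
def degreePart (K : Type*) [Field K] (n : ℕ) : Submodule K (V K) :=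
  Submodule.span K (varProd K '' (partsFinset n : Set (Multiset ℕ)))

theorem varProd_mem_degreePart {n : ℕ} {s : Multiset ℕ} (hs : s ∈ partsFinset n) :
    varProd K s ∈ degreePart K n :=
  Submodule.subset_span ⟨s, hs, rfl⟩

theorem halfCoeff_mem_degreePart (ε : K) (k : ℕ) : halfCoeff t ε k ∈ degreePart K k := by
  rw [halfCoeff_natCast]
  exact Submodule.sum_mem _ fun s hs => Submodule.smul_mem _ _ (varProd_mem_degreePart hs)

theorem mul_varProd_mem_degreePart {a b : ℕ} {f : V K} (hf : f ∈ degreePart K a) {s : Multiset ℕ}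
    (hs : s ∈ partsFinset b) : f * varProd K s ∈ degreePart K (a + b) := by
  induction hf using Submodule.span_induction with
  | mem f hf =>
    obtain ⟨u, hu, rfl⟩ := hf
    rw [← varProd_add]
    refine varProd_mem_degreePart ?_
    rw [Finset.mem_coe, mem_partsFinset] at hu
    rw [mem_partsFinset] at hs ⊢
    refine ⟨fun i hi => ?_, by rw [Multiset.sum_add, hu.2, hs.2]⟩
    rcases Multiset.mem_add.mp hi with hi | hi
    · exact hu.1 i hi
    · exact hs.1 i hi
  | zero => rw [zero_mul]; exact Submodule.zero_mem _
  | add f g _ _ hf hg => rw [add_mul]; exact Submodule.add_mem _ hf hg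
  | smul c f _ hf => rw [smul_mul_assoc]; exact Submodule.smul_mem _ _ hf

theorem creation_mem_degreePart (a : ℕ) {d : ℕ} {f : V K} (hf : f ∈ degreePart K d) :
    creation t a f ∈ degreePart K (a + d) := by
  induction hf using Submodule.span_induction with
  | mem f hf =>
    obtain ⟨s, hs, rfl⟩ := hf
    rw [Finset.mem_coe, mem_partsFinset] at hs
    rw [creation, vertexOp_varProd]
    refine multiset_sum_mem _ fun g hg => ?_
    obtain ⟨u, hu, rfl⟩ := Multiset.mem_map.mp hg
    rw [Multiset.mem_powerset] at hu
    have hsum : (s - u).sum + u.sum = d := by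
      rw [← Multiset.sum_add, tsub_add_cancel_of_le hu, hs.2]
    refine Submodule.smul_mem _ _ ?_
    rw [← hsum, ← add_assoc]
    refine mul_varProd_mem_degreePart (by exact_mod_cast halfCoeff_mem_degreePart t 1 _) ?_
    rw [mem_partsFinset]
    exact ⟨fun i hi => hs.1 i (Multiset.mem_of_le hu hi), rfl⟩
  | zero => rw [map_zero]; exact Submodule.zero_mem _
  | add f g _ _ hf hg => rw [map_add]; exact Submodule.add_mem _ hf hg
  | smul c f _ hf => rw [map_smul]; exact Submodule.smul_mem _ _ hf

theorem creationList_mem_degreePart (R : List ℕ) : creationList t R ∈ degreePart K R.sum := by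
  induction R with
  | nil =>
    rw [creationList, ← varProd_zero]
    exact varProd_mem_degreePart (mem_partsFinset.mpr ⟨by simp, rfl⟩)
  | cons a R ih => exact creation_mem_degreePart t a ih

theorem exists_eq_sum_varProd {n : ℕ} {f : V K} (hf : f ∈ degreePart K n) :
    ∃ c : n.Partition → K, f = ∑ rho, c rho • varProd K rho.parts := by
  have h : varProd K '' (partsFinset n : Set (Multiset ℕ)) =
      Set.range fun rho : n.Partition => varProd K rho.parts := by
    rw [partsFinset, Finset.coe_image, Finset.coe_univ, Set.image_univ, ← Set.range_comp]
    rfl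
  rw [degreePart, h, Submodule.mem_span_range_iff_exists_fun] at hf
  obtain ⟨c, hc⟩ := hf
  exact ⟨c, hc.symm⟩

end Span

section Green

theorem subCount_zero_left (s : Multiset ℕ) : subCount 0 s = 1 := by
  unfold subCount
  induction s using Multiset.induction_on with
  | empty => simp
  | cons k s ih =>
    rw [Multiset.powerset_cons, Multiset.count_add, ih, Multiset.count_eq_zero_of_notMem]
    simp

/-- The parts not kept raise the index from -a to N - |τ|. Hence the condition |τ| ≤ N: larger τ
meet a coefficient of negative index. -/
theorem annihilation_varProd {a N : ℕ} {s : Multiset ℕ} (hs : ∀ i ∈ s, 0 < i)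
    (hsum : s.sum = a + N) :
    annihilation t a (varProd K s) = ∑ k ∈ Finset.range (N + 1), ∑ u ∈ partsFinset k,
      subCount u s • (halfCoeff t (-1) (N - k : ℕ) * varProd K u) := by
  classical
  have h1 : ∀ k ∈ Finset.range (N + 1), ∑ u ∈ partsFinset k,
      subCount u s • (halfCoeff t (-1) (N - k : ℕ) * varProd K u) = ∑ u ∈ partsFinset k,
      subCount u s • (halfCoeff t (-1) (N - u.sum : ℤ) * varProd K u) := by
    intro k hk
    rw [Finset.mem_range] at hk
    refine Finset.sum_congr rfl fun u hu => ?_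
    rw [(mem_partsFinset.mp hu).2, Nat.cast_sub (by omega)]
  rw [Finset.sum_congr rfl h1, ← Finset.sum_biUnion, annihilation, vertexOp_varProd,
    Finset.sum_multiset_map_count]
  · have h2 : ∀ u ∈ s.powerset.toFinset, s.powerset.count u • ((1 : K) ^ Multiset.card (s - u) •
        (halfCoeff t (-1) (-(a : ℤ) + (s - u).sum) * varProd K u)) =
        subCount u s • (halfCoeff t (-1) (N - u.sum : ℤ) * varProd K u) := by
      intro u hu
      rw [Multiset.mem_toFinset, Multiset.mem_powerset] at hu
      have hsub : (s - u).sum + u.sum = a + N := by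
        rw [← Multiset.sum_add, tsub_add_cancel_of_le hu, hsum]
      rw [one_pow, one_smul, show -(a : ℤ) + (s - u).sum = N - u.sum by omega, subCount]
    rw [Finset.sum_congr rfl h2]
    rw [Finset.sum_subset (Finset.subset_union_left
      (s₂ := (Finset.range (N + 1)).biUnion partsFinset))]
    · symm
      refine Finset.sum_subset Finset.subset_union_right fun u hu hu' => ?_
      have hmem : u ∈ s.powerset.toFinset := (Finset.mem_union.mp hu).resolve_right hu'
      rw [Multiset.mem_toFinset, Multiset.mem_powerset] at hmem
      rw [halfCoeff_of_neg, zero_mul, smul_zero]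
      by_contra hN
      refine hu' (Finset.mem_biUnion.mpr ⟨u.sum, Finset.mem_range.mpr (by omega), ?_⟩)
      exact mem_partsFinset.mpr ⟨fun i hi => hs i (Multiset.mem_of_le hmem hi), rfl⟩
    · intro u _ hu
      rw [Multiset.mem_toFinset] at hu
      rw [subCount, Multiset.count_eq_zero_of_notMem hu, zero_smul]
  · intro k _ k' _ hkk'
    refine Finset.disjoint_left.mpr fun u hu hu' => hkk' ?_
    rw [← (mem_partsFinset.mp hu).2, (mem_partsFinset.mp hu').2]

/-- The factor `(-1) ^ l(ρ) / z_ρ(t)` of a pair `(τ, ρ)`. -/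
def pairWeight {N : ℕ} (s : PartPair N) : K := (-1) ^ (Multiset.card s.rho) / z t s.rho

theorem annihilation_varProd_eq_sum_partPair {a N : ℕ} {s : Multiset ℕ} (hs : ∀ i ∈ s, 0 < i)
    (hsum : s.sum = a + N) :
    annihilation t a (varProd K s) = ∑ x : PartPair N,
      ((subCount x.tau s : K) * pairWeight t x) • varProd K (x.tau + x.rho) := by
  rw [annihilation_varProd t hs hsum, Fintype.sum_sigma, Finset.sum_range fun k =>
    ∑ u ∈ partsFinset k, subCount u s • (halfCoeff t (-1) (N - k : ℕ) * varProd K u)]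
  refine Finset.sum_congr rfl fun k _ => ?_
  rw [Fintype.sum_prod_type, ← sum_partition]
  refine Finset.sum_congr rfl fun u _ => ?_
  rw [halfCoeff_natCast, ← sum_partition _ fun s => ((-1 : K) ^ Multiset.card s / z t s) •
    varProd K s, Finset.sum_mul, Finset.smul_sum]
  refine Finset.sum_congr rfl fun r _ => ?_
  rw [← Nat.cast_smul_eq_nsmul K, smul_mul_assoc, smul_smul, mul_comm (varProd K _),
    ← varProd_add]
  rfl

/-- The sum `greenSum` for arbitrary weights `N`. -/
def greenAux {m : ℕ} (N : Fin m → ℕ) (s : Multiset ℕ) : K :=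
  ∑ x : (i : Fin m) → PartPair (N i),
    ((∏ j, subCount (x j).tau (Fin.cons (α := fun _ => Multiset ℕ) s
      (fun j => (x j).tau + (x j).rho) j.castSucc) : ℕ) : K) * ∏ j, pairWeight t (x j)

theorem greenAux_zero (N : Fin 0 → ℕ) (s : Multiset ℕ) : greenAux t N s = 1 := by
  simp [greenAux]

theorem greenAux_succ {m : ℕ} (N : Fin (m + 1) → ℕ) (s : Multiset ℕ) :
    greenAux t N s = ∑ y : PartPair (N 0), ((subCount y.tau s : K) * pairWeight t y) *
      greenAux t (fun i => N i.succ) (y.tau + y.rho) := by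
  unfold greenAux
  rw [← (Fin.consEquiv fun i => PartPair (N i)).sum_comp, Fintype.sum_prod_type]
  refine Finset.sum_congr rfl fun y _ => ?_
  rw [Finset.mul_sum]
  refine Finset.sum_congr rfl fun x _ => ?_
  rw [Fin.prod_univ_succ, Fin.prod_univ_succ]
  have h : ∀ j : Fin m, Fin.cons (α := fun _ => Multiset ℕ) s
      (fun j => ((Fin.consEquiv fun i => PartPair (N i)) (y, x) j).tau +
        ((Fin.consEquiv fun i => PartPair (N i)) (y, x) j).rho) j.succ.castSucc =
      Fin.cons (α := fun _ => Multiset ℕ) (y.tau + y.rho) (fun j => (x j).tau + (x j).rho)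
        j.castSucc := by
    intro j
    rw [← Fin.succ_castSucc, Fin.cons_succ]
    refine Fin.cases ?_ (fun i => ?_) j.castSucc
    · rfl
    · rfl
  simp only [h]
  rw [Nat.cast_mul, mul_mul_mul_comm]
  rfl

/-- Each part of R but the last contributes one pair (τ, ρ), and τ ∪ ρ is passed on to the next
operator. -/
theorem annihilationList_varProd (R : List ℕ) (s : Multiset ℕ) (hs : ∀ i ∈ s, 0 < i)
    (hsum : s.sum = R.sum) : annihilationList t R (varProd K s) =
      greenAux t (fun i : Fin (R.length - 1) => (R.drop (i + 1)).sum) s := by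
  induction R generalizing s with
  | nil =>
    have h0 : s ∈ partsFinset 0 := mem_partsFinset.mpr ⟨hs, hsum⟩
    rw [partsFinset_zero, Finset.mem_singleton] at h0
    rw [h0, varProd_zero]
    exact vacuum_one.trans (greenAux_zero t _ _).symm
  | cons a R ih =>
    rw [annihilationList, LinearMap.comp_apply]
    cases R with
    | nil =>
      -- For the last part N = 0, so only τ = ∅ survives, with factor 1. This is why there are l(λ)
      -- - 1 pairs.
      rw [annihilation_varProd t hs (hsum.trans List.sum_cons), List.sum_nil, zero_add,
        Finset.sum_range_one, partsFinset_zero, Finset.sum_singleton, subCount_zero_left,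
        varProd_zero, one_smul, mul_one]
      refine Eq.trans ?_ (greenAux_zero t _ _).symm
      rw [show ((0 - 0 : ℕ) : ℤ) = 0 by simp, halfCoeff_zero]
      exact vacuum_one
    | cons b R =>
      rw [annihilation_varProd_eq_sum_partPair t hs (hsum.trans List.sum_cons), map_sum]
      refine Eq.trans ?_ (greenAux_succ t _ _).symm
      refine Finset.sum_congr rfl fun x _ => ?_
      rw [map_smul, smul_eq_mul, ih]
      · rfl
      · intro i hi
        rcases Multiset.mem_add.mp hi with hi | hi
        · exact x.2.1.parts_pos hi
        · exact x.2.2.parts_pos hi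
      · rw [Multiset.sum_add, PartPair.tau, PartPair.rho, x.2.1.parts_sum, x.2.2.parts_sum]
        omega

theorem rows_sum {n : ℕ} (lam : n.Partition) : (rows lam).sum = n := by
  rw [← Multiset.sum_coe, rows, Multiset.sort_eq, lam.parts_sum]

theorem annihilationList_rows {n : ℕ} (lam mu : n.Partition) :
    annihilationList t (rows lam) (varProd K mu.parts) = greenSum t lam mu :=
  annihilationList_varProd t (rows lam) mu.parts (fun _ hi => mu.parts_pos hi)
    (mu.parts_sum.trans (rows_sum lam).symm)

end Green

end GreenPolynomials

section Main

variable {K : Type*} [Field K] (t : K)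

/-! ### Linear independence of the power sum products. -/

section PowerSums

open scoped Classical in
/-- The power sum `p_k` with natural number coefficients. -/
def natPsum (k : ℕ) : MvPowerSeries ℕ ℕ :=
  fun e => if ∃ i : ℕ, e = Finsupp.single i k then 1 else 0

theorem coeff_natPsum (k : ℕ) (e : ℕ →₀ ℕ) [Decidable (∃ i : ℕ, e = Finsupp.single i k)] :
    MvPowerSeries.coeff e (natPsum k) = if ∃ i : ℕ, e = Finsupp.single i k then 1 else 0 := by
  rw [MvPowerSeries.coeff_apply, natPsum]
  congr

theorem map_natPsum (k : ℕ) : MvPowerSeries.map (Nat.castRingHom K) (natPsum k) = psum K k := by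
  classical
  ext e
  rw [MvPowerSeries.coeff_map, coeff_natPsum, MvPowerSeries.coeff_apply, psum]
  split_ifs <;> simp

theorem psumPart_eq_map (s : Multiset ℕ) :
    psumPart K s = MvPowerSeries.map (Nat.castRingHom K) (s.map natPsum).prod := by
  rw [map_multiset_prod, Multiset.map_map, psumPart]
  congr 2
  ext1 k
  exact (map_natPsum k).symm

/-- The nonzero exponents of a monomial. -/
def exponents (e : ℕ →₀ ℕ) : Multiset ℕ := e.support.val.map e

theorem exponents_single_add {e : ℕ →₀ ℕ} {i k : ℕ} (hk : 0 < k) (hi : i ∉ e.support) :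
    exponents (Finsupp.single i k + e) = k ::ₘ exponents e := by
  have hdisj : Disjoint (Finsupp.single i k).support e.support := by
    rw [Finsupp.support_single i hk.ne']
    exact Finset.disjoint_singleton_left.mpr hi
  have hei : e i = 0 := Finsupp.notMem_support_iff.mp hi
  rw [exponents, Finsupp.support_add_eq hdisj, Finsupp.support_single i hk.ne',
    ← Finset.insert_eq, Finset.insert_val_of_notMem hi, Multiset.map_cons, exponents]
  congr 1
  · simp [hei]
  · refine Multiset.map_congr rfl fun j hj => ?_
    have hji : i ≠ j := fun h => hi (h ▸ hj)
    simp [Finsupp.single_eq_of_ne' hji]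

/-- A monomial of `p_s` has at most as many variables as `s` has parts, and if it has as many then
its exponents are the parts of `s`. -/
theorem card_support_le_of_coeff_ne_zero {s : Multiset ℕ} (hs : ∀ k ∈ s, 0 < k) {e : ℕ →₀ ℕ}
    (he : MvPowerSeries.coeff e (s.map natPsum).prod ≠ 0) :
    e.support.card ≤ Multiset.card s ∧
      (e.support.card = Multiset.card s → exponents e = s) := by
  classical
  induction s using Multiset.induction_on generalizing e with
  | empty =>
    rw [Multiset.map_zero, Multiset.prod_zero, MvPowerSeries.coeff_one] at he
    have h0 : e = 0 := by
      by_contra h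
      exact he (if_neg h)
    subst h0
    simp [exponents]
  | cons k s ih =>
    rw [Multiset.map_cons, Multiset.prod_cons, MvPowerSeries.coeff_mul] at he
    obtain ⟨p, hp, hne⟩ := Finset.exists_ne_zero_of_sum_ne_zero he
    rw [Finset.HasAntidiagonal.mem_antidiagonal] at hp
    have h1 := left_ne_zero_of_mul hne
    have h2 := right_ne_zero_of_mul hne
    rw [coeff_natPsum] at h1
    obtain ⟨i, hi⟩ : ∃ i : ℕ, p.1 = Finsupp.single i k := by
      by_contra h
      exact h1 (if_neg h)
    have hk := hs k (Multiset.mem_cons_self _ _)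
    obtain ⟨hle, heq⟩ := ih (fun j hj => hs j (Multiset.mem_cons_of_mem hj)) h2
    rw [hi] at hp
    rw [← hp, Multiset.card_cons]
    by_cases hmem : i ∈ p.2.support
    · have hsupp : (Finsupp.single i k + p.2).support ⊆ p.2.support := by
        refine Finsupp.support_add.trans (Finset.union_subset ?_ le_rfl)
        exact Finsupp.support_single_subset.trans (Finset.singleton_subset_iff.mpr hmem)
      have := Finset.card_le_card hsupp
      exact ⟨by omega, fun h => by omega⟩
    · have hcard : (Finsupp.single i k + p.2).support.card = p.2.support.card + 1 := by
        have h := congrArg Multiset.card (exponents_single_add hk hmem)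
        simpa [exponents] using h
      refine ⟨by omega, fun h => ?_⟩
      rw [exponents_single_add hk hmem, heq (by omega)]

/-- Give each part its own variable. Coefficients in ℕ cannot cancel, so one nonzero contribution
suffices. -/
theorem exists_coeff_ne_zero {s : Multiset ℕ} (hs : ∀ k ∈ s, 0 < k) :
    ∃ e : ℕ →₀ ℕ, exponents e = s ∧ MvPowerSeries.coeff e (s.map natPsum).prod ≠ 0 := by
  classical
  induction s using Multiset.induction_on with
  | empty => exact ⟨0, by simp [exponents], by simp⟩
  | cons k s ih =>
    obtain ⟨e, he, hne⟩ := ih fun j hj => hs j (Multiset.mem_cons_of_mem hj)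
    obtain ⟨i, hi⟩ := Infinite.exists_notMem_finset e.support
    refine ⟨Finsupp.single i k + e, ?_, ?_⟩
    · rw [exponents_single_add (hs k (Multiset.mem_cons_self _ _)) hi, he]
    · rw [Multiset.map_cons, Multiset.prod_cons, MvPowerSeries.coeff_mul]
      intro h0
      have h := Finset.sum_eq_zero_iff.mp h0 (Finsupp.single i k, e)
        (Finset.HasAntidiagonal.mem_antidiagonal.mpr rfl)
      rw [coeff_natPsum, if_pos ⟨i, rfl⟩, one_mul] at h
      exact hne h

variable [CharZero K]

/-- The power sums `p_ρ` are linearly independent. -/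
theorem linearIndependent_psumPart (n : ℕ) :
    LinearIndependent K fun rho : n.Partition => psumPart K rho.parts := by
  classical
  rw [Fintype.linearIndependent_iff]
  intro c hc
  by_contra! h
  have hne : (Finset.univ.filter fun rho => c rho ≠ 0).Nonempty :=
    h.imp fun rho hrho => Finset.mem_filter.mpr ⟨Finset.mem_univ _, hrho⟩
  -- Take μ with the most parts among the nonzero coefficients. A monomial with exponents μ then
  -- occurs in no other p_ρ of the relation.
  obtain ⟨mu, hmu, hmax⟩ := Finset.exists_max_image _
    (fun rho : n.Partition => Multiset.card rho.parts) hne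
  rw [Finset.mem_filter] at hmu
  obtain ⟨e, he, hcoeff⟩ := exists_coeff_ne_zero fun k hk => mu.parts_pos hk
  have hcard : e.support.card = Multiset.card mu.parts := by
    rw [← he, exponents, Multiset.card_map, Finset.card_val]
  have h0 := congrArg (MvPowerSeries.coeff e) hc
  rw [map_sum, Finset.sum_eq_single mu] at h0
  · rw [map_smul, map_zero, psumPart_eq_map, MvPowerSeries.coeff_map, smul_eq_mul, mul_eq_zero] at h0
    refine h0.elim hmu.2 fun h1 => hcoeff ?_
    rwa [Nat.coe_castRingHom, Nat.cast_eq_zero] at h1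
  · intro rho _ hrho
    rw [map_smul, psumPart_eq_map, MvPowerSeries.coeff_map, smul_eq_mul]
    by_cases hc0 : c rho = 0
    · rw [hc0, zero_mul]
    · have hle := hmax rho (Finset.mem_filter.mpr ⟨Finset.mem_univ _, hc0⟩)
      have hz : MvPowerSeries.coeff e (rho.parts.map natPsum).prod = 0 := by
        by_contra hnz
        obtain ⟨h1, h2⟩ := card_support_le_of_coeff_ne_zero (fun k hk => rho.parts_pos hk) hnz
        exact hrho (Nat.Partition.ext ((h2 (by omega)).symm.trans he))
      rw [hz, map_zero, mul_zero]
  · exact fun h => absurd (Finset.mem_univ _) h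

end PowerSums

/-! ### Existence and uniqueness of the expansion. -/

section Expansion

variable [CharZero K]

theorem annihilationList_rows_creationList_rows {n : ℕ} (lam mu : n.Partition) :
    annihilationList t (rows lam) (creationList t (rows mu)) = if lam = mu then b t lam else 0 := by
  have hrows : ∀ nu : n.Partition, (rows nu).Pairwise (· ≥ ·) := fun nu =>
    Multiset.pairwise_sort _ _
  have hcoe : ∀ nu : n.Partition, (rows nu : Multiset ℕ) = nu.parts := fun nu =>
    Multiset.sort_eq _ _
  have hpos : ∀ nu : n.Partition, ∀ x ∈ rows nu, 0 < x := fun nu x hx =>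
    nu.parts_pos (by rwa [← hcoe nu, Multiset.mem_coe])
  rw [annihilationList_creationList t (hrows lam) (hrows mu) (hpos lam) (hpos mu), hcoe]
  refine if_congr ⟨fun h => Nat.Partition.ext ?_, fun h => h ▸ rfl⟩ rfl rfl
  rw [← hcoe lam, h, hcoe mu]

/-- The power sums expand in the Hall–Littlewood functions with the coefficients `greenSum`, and
these coefficients are unique. -/
theorem psumPart_eq_sum_hallP_iff (ht : ∀ k, 0 < k → t ^ k ≠ 1) {n : ℕ} (mu : n.Partition)
    (X : n.Partition → K) :
    psumPart K mu.parts = ∑ lam, X lam • hallP t lam ↔ ∀ lam, X lam = greenSum t lam mu := by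
  classical
  have hex : ∀ lam : n.Partition, ∃ c : n.Partition → K,
      creationList t (rows lam) = ∑ rho, c rho • varProd K rho.parts := by
    intro lam
    have h := creationList_mem_degreePart t (rows lam)
    rw [rows_sum] at h
    exact exists_eq_sum_varProd h
  choose c hc using hex
  have hb : ∀ lam : n.Partition, b t lam ≠ 0 := fun lam => bMultiset_ne_zero t ht lam.parts
  let G : Matrix n.Partition n.Partition K := Matrix.of fun lam rho => greenSum t lam rho
  let P : Matrix n.Partition n.Partition K := Matrix.of fun rho lam => (b t lam)⁻¹ * c lam rho
  have hGP : G * P = 1 := by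
    ext lam nu
    have h := annihilationList_rows_creationList_rows t lam nu
    rw [hc nu, map_sum] at h
    simp only [map_smul, annihilationList_rows, smul_eq_mul] at h
    rw [Matrix.mul_apply, Matrix.one_apply]
    have h' : ∑ rho, G lam rho * P rho nu =
        (b t nu)⁻¹ * ∑ rho, c nu rho * greenSum t lam rho := by
      rw [Finset.mul_sum]
      refine Finset.sum_congr rfl fun rho _ => ?_
      simp only [G, P, Matrix.of_apply]
      ring
    rw [h', h]
    split_ifs with hln
    · rw [hln, inv_mul_cancel₀ (hb nu)]
    · rw [mul_zero]
  -- Orthogonality gives only a left inverse. Both indices run over the partitions of n, so it is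
  -- two-sided, and the expansion exists as well as being unique.
  have hPG : P * G = 1 := mul_eq_one_comm.mp hGP
  have hP : ∀ lam, hallP t lam = ∑ rho, P rho lam • psumPart K rho.parts := by
    intro lam
    rw [hallP, hallQ_eq, hc, map_sum, Finset.smul_sum]
    refine Finset.sum_congr rfl fun rho _ => ?_
    rw [map_smul, varProd, toSeries_prod_X, smul_smul]
    rfl
  have hexp : ∀ Y : n.Partition → K,
      ∑ lam, Y lam • hallP t lam = ∑ rho, (P.mulVec Y) rho • psumPart K rho.parts := by
    intro Y
    simp only [hP, Finset.smul_sum, Matrix.mulVec, dotProduct, Finset.sum_smul, smul_smul]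
    rw [Finset.sum_comm]
    simp only [mul_comm]
  have hone : psumPart K mu.parts =
      ∑ rho, ((Pi.single mu 1 : n.Partition → K) rho) • psumPart K rho.parts := by
    rw [Finset.sum_eq_single mu]
    · simp
    · intro rho _ hrho
      simp [hrho]
    · exact fun h => absurd (Finset.mem_univ _) h
  have hcol : ∀ lam, (G.mulVec (Pi.single mu 1)) lam = greenSum t lam mu := by
    intro lam
    rw [Matrix.mulVec_single_one]
    rfl
  rw [hexp, hone]
  constructor
  · intro h lam
    have h1 : Pi.single mu 1 = P.mulVec X :=
      (linearIndependent_psumPart n).fintypeLinearCombination_injective h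
    rw [← hcol, h1, Matrix.mulVec_mulVec, hGP, Matrix.one_mulVec]
  · intro h
    have h1 : X = G.mulVec (Pi.single mu 1) := funext fun lam => (h lam).trans (hcol lam).symm
    rw [h1, Matrix.mulVec_mulVec, hPG, Matrix.one_mulVec]

end Expansion

/-! ### The case t = 0: complete symmetric and Schur functions. -/

section Specialization

theorem coeff_psum_mul {k : ℕ} (hk : 0 < k) (F : MvPowerSeries ℕ K) (e : ℕ →₀ ℕ) :
    MvPowerSeries.coeff e (psum K k * F) = ∑ i ∈ e.support,
      if k ≤ e i then MvPowerSeries.coeff (e - Finsupp.single i k) F else 0 := by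
  classical
  rw [MvPowerSeries.coeff_mul, ← Finset.sum_filter]
  symm
  refine Finset.sum_of_injOn (fun i => (Finsupp.single i k, e - Finsupp.single i k)) ?_ ?_ ?_ ?_
  · intro i _ j _ hij
    exact Finsupp.single_left_injective hk.ne' (congrArg Prod.fst hij)
  · intro i hi
    simp only [Finset.coe_filter, Set.mem_ofPred_eq] at hi
    rw [Finset.mem_coe, Finset.HasAntidiagonal.mem_antidiagonal]
    exact add_tsub_cancel_of_le (Finsupp.single_le_iff.mpr hi.2)
  · intro p hp hnot
    rw [Finset.HasAntidiagonal.mem_antidiagonal] at hp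
    rw [MvPowerSeries.coeff_apply (psum K k), psum, if_neg, zero_mul]
    rintro ⟨i, hi⟩
    refine hnot ⟨i, ?_, ?_⟩
    · have hle : k ≤ e i := by
        rw [← hp, hi]
        simp
      rw [Finset.mem_coe, Finset.mem_filter, Finsupp.mem_support_iff]
      exact ⟨by omega, hle⟩
    · refine Prod.ext hi.symm ?_
      change e - Finsupp.single i k = p.2
      rw [← hi, ← hp, add_tsub_cancel_left]
  · intro i _
    rw [MvPowerSeries.coeff_apply (psum K k), psum, if_pos ⟨i, rfl⟩, one_mul]

theorem coeff_hsymm (m : ℤ) (e : ℕ →₀ ℕ) :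
    MvPowerSeries.coeff e (hsymm K m) = if (e.degree : ℤ) = m then 1 else 0 := by
  rw [MvPowerSeries.coeff_apply, hsymm]

/-- In the coefficient of a monomial of degree n, the variable x_i is counted once for each k with 1
≤ k ≤ e_i, giving ∑ e_i = n in total. -/
theorem hsymm_newton (n : ℕ) :
    n • hsymm K n = ∑ k ∈ Finset.range (n + 1),
      (if k = 0 then 0 else psum K k) * hsymm K (n - k : ℕ) := by
  ext e
  have hk : ∀ k ∈ Finset.range (n + 1), MvPowerSeries.coeff e
      ((if k = 0 then 0 else psum K k) * hsymm K (n - k : ℕ)) =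
      ∑ i ∈ e.support, if 0 < k ∧ k ≤ e i then (if e.degree = n then 1 else 0) else 0 := by
    intro k hk
    rw [Finset.mem_range] at hk
    rcases Nat.eq_zero_or_pos k with rfl | hk0
    · simp
    · rw [if_neg hk0.ne', coeff_psum_mul hk0]
      refine Finset.sum_congr rfl fun i _ => ?_
      by_cases hki : k ≤ e i
      · rw [if_pos hki, if_pos ⟨hk0, hki⟩, coeff_hsymm]
        have hdeg : (e - Finsupp.single i k).degree + k = e.degree := by
          conv_rhs => rw [← tsub_add_cancel_of_le (Finsupp.single_le_iff.mpr hki)]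
          rw [map_add, Finsupp.degree_single]
        exact if_congr (by omega) rfl rfl
      · rw [if_neg hki, if_neg fun h => hki h.2]
  rw [map_sum, Finset.sum_congr rfl hk, Finset.sum_comm, map_nsmul, coeff_hsymm]
  by_cases hd : e.degree = n
  · simp only [hd, if_true]
    have hi : ∀ i ∈ e.support, ∑ k ∈ Finset.range (n + 1),
        (if 0 < k ∧ k ≤ e i then (1 : K) else 0) = e i := by
      intro i _
      have hle : e i ≤ n := hd ▸ Finsupp.le_degree i e
      rw [← Finset.sum_filter, Finset.sum_const, nsmul_one]
      congr 1
      have : (Finset.range (n + 1)).filter (fun k => 0 < k ∧ k ≤ e i) = Finset.Icc 1 (e i) := by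
        ext k
        simp only [Finset.mem_filter, Finset.mem_range, Finset.mem_Icc]
        omega
      rw [this, Nat.card_Icc, Nat.add_sub_cancel]
    rw [Finset.sum_congr rfl hi, nsmul_one, ← Nat.cast_sum, ← hd, Finsupp.degree_apply]
  · have hd' : ¬ (e.degree : ℤ) = n := by exact_mod_cast hd
    simp [hd, hd']

variable [CharZero K]

theorem toSeries_halfCoeff_zero (m : ℤ) : toSeries K (halfCoeff 0 1 m) = hsymm K m := by
  rcases lt_or_ge m 0 with hm | hm
  · rw [halfCoeff_of_neg 0 hm, map_zero]
    ext e
    rw [coeff_hsymm, if_neg (by omega), map_zero]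
  · obtain ⟨n, rfl⟩ := Int.eq_ofNat_of_zero_le hm
    have h := map_intCoeff ((toSeries K : V K →ₐ[K] MvPowerSeries ℕ K) : V K →+* MvPowerSeries ℕ K)
      (halfSeries 0 1) n
    have h1 : hsymm K n = PowerSeries.coeff n (expSeries K (psum K)) := by
      refine coeff_eq_coeff_expSeries K (f := fun n : ℕ => hsymm K n) ?_ hsymm_newton n
      ext e
      rw [coeff_hsymm, MvPowerSeries.coeff_one]
      exact if_congr (by rw [Nat.cast_inj, Finsupp.degree_eq_zero_iff]) rfl rfl
    -- 1 - 0^k is 1 only for k > 0; the value at k = 0 never enters, since parts are positive.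
    have h2 : expSeries K (fun k => toSeries K (((1 : K) * (1 - 0 ^ k)) • MvPolynomial.X k)) =
        expSeries K (psum K) := by
      refine expSeries_congr K fun i hi => ?_
      rw [zero_pow hi.ne', sub_zero, one_mul, one_smul]
      exact MvPolynomial.aeval_X _ _
    rw [halfSeries, map_expSeries, h2] at h
    rw [h1, ← intCoeff_natCast, ← h]
    rfl

/-- At `t = 0` the Hall–Littlewood functions are the Schur functions. -/
theorem hallP_zero {n : ℕ} (lam : n.Partition) : hallP 0 lam = schur K lam := by
  have hb : b (0 : K) lam = 1 := by
    refine Finset.prod_eq_one fun i _ => Finset.prod_eq_one fun j hj => ?_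
    rw [zero_pow (by have := (Finset.mem_Icc.mp hj).1; omega), sub_zero]
  rw [hallP, hb, inv_one, one_smul, hallQ_eq, creationList_zero, AlgHom.map_det, schur]
  congr 1
  ext1 i j
  exact toSeries_halfCoeff_zero _

end Specialization

/-! ### Polynomiality in t. -/

section Polynomiality

/-- `greenSum` as a polynomial in `t`. -/
def greenPoly {n : ℕ} (lam mu : n.Partition) : Polynomial ℚ :=
  ∑ s : PairSeq lam,
    ((∏ j, subCount (s j).tau (unions lam mu s j.castSucc) : ℕ) : Polynomial ℚ) *
      ∏ j, ((-1) ^ (Multiset.card (s j).rho) * (Polynomial.C ((zNum (s j).rho : ℚ)⁻¹) *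
        ((s j).rho.map fun i => 1 - Polynomial.X ^ i).prod))

theorem aeval_greenPoly [Algebra ℚ K] {n : ℕ} (lam mu : n.Partition) :
    Polynomial.aeval t (greenPoly lam mu) = greenSum t lam mu := by
  rw [greenPoly, greenSum, map_sum]
  refine Finset.sum_congr rfl fun s _ => ?_
  rw [map_mul, map_natCast, map_prod]
  congr 1
  refine Finset.prod_congr rfl fun j _ => ?_
  rw [map_mul, map_mul, map_pow, map_neg, map_one, Polynomial.aeval_C, map_inv₀, map_natCast,
    map_multiset_prod, Multiset.map_map, z, div_div_eq_mul_div, mul_div_assoc, div_eq_inv_mul]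
  congr 4
  ext1 i
  simp

end Polynomiality

end Main

end HallLittlewood

end

theorem theoremt (n : ℕ) (mu : n.Partition) :
    (∀ X : n.Partition → RatFunc ℚ, HallLittlewood.IsGreen mu X ↔
      ∀ lam : n.Partition, X lam = HallLittlewood.greenSum RatFunc.X lam mu) ∧
    (∀ lam : n.Partition, ∃ G : Polynomial ℚ,
      algebraMap (Polynomial ℚ) (RatFunc ℚ) G = HallLittlewood.greenSum RatFunc.X lam mu ∧
      G.eval 0 = HallLittlewood.greenSum 0 lam mu) ∧
    (∀ chi : n.Partition → ℚ, HallLittlewood.IsFrobenius mu chi ↔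
      ∀ lam : n.Partition, chi lam = HallLittlewood.greenSum 0 lam mu) := by
  have hX : ∀ k, 0 < k → (RatFunc.X : RatFunc ℚ) ^ k ≠ 1 := by
    intro k hk h
    rw [← RatFunc.algebraMap_X, ← map_pow, ← map_one (algebraMap (Polynomial ℚ) (RatFunc ℚ))] at h
    have h1 := congrArg Polynomial.natDegree (RatFunc.algebraMap_injective ℚ h)
    rw [Polynomial.natDegree_X_pow, Polynomial.natDegree_one] at h1
    omega
  have h0 : ∀ k, 0 < k → (0 : ℚ) ^ k ≠ 1 := by
    intro k hk
    rw [zero_pow hk.ne']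
    exact zero_ne_one
  refine ⟨fun X => HallLittlewood.psumPart_eq_sum_hallP_iff RatFunc.X hX mu X,
    fun lam => ⟨HallLittlewood.greenPoly lam mu, ?_, ?_⟩, fun chi => ?_⟩
  · rw [← HallLittlewood.aeval_greenPoly RatFunc.X lam mu, ← RatFunc.algebraMap_X,
      Polynomial.aeval_algebraMap_apply, Polynomial.aeval_X_left_apply]
  · rw [← HallLittlewood.aeval_greenPoly 0 lam mu, Polynomial.coe_aeval_eq_eval]
  · rw [← HallLittlewood.psumPart_eq_sum_hallP_iff 0 h0 mu chi]
    simp only [HallLittlewood.hallP_zero]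
    rfl
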